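/- **Conventions.** $Z$ is a connected finite graph without vertices of valence $1$, $\beta:Z\to Z$ is a $\pi_1$-injective cellular map which on each edge is locally injective or constant and all of whose fixed points are vertices, and $Z_0\subsetneq Z$ is a $\beta$-invariant subgraph containing all vertices; $\beta_0=\beta|_{Z_0}$. A *path* is a locally injective or trivial edge path, $[\sigma]$ is the tightened form of $\sigma$, $\bar\sigma$ its reverse, and $D\beta(e)$ is the first oriented edge of $\beta(e)$. A *turn* (a pair of oriented edges issuing from the same vertex) is *illegal* if some iterate of $D\beta$ makes it degenerate (two equal edges); a path is *$\beta$-legal* if it contains no illegal turn formed by two edges of $Z\setminus Z_0$. A *Nielsen path* is a nontrivial path $p$ between fixed points with $\beta\circ p\simeq p$ rel endpoints; it is *indivisible* if it is not a concatenation of two Nielsen paths. The map $\beta:(Z,Z_0)\to(Z,Z_0)$ is a *relative train track (RTT) map of Type 3* if there are $\lambda>1$ and a length function $L$, zero on the edges of $Z_0$ and positive on those of $Z\setminus Z_0$, with $L(\beta(e))=\lambda L(e)$ for every edge $e$ of $Z\setminus Z_0$, and - (a) $D\beta(e)$ lies in $Z\setminus Z_0$ for every oriented edge $e$ of $Z\setminus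 Z_0$; if $\alpha$ is a nontrivial path in $Z_0$ whose endpoints are endpoints of edges of $Z\setminus Z_0$, then $[\beta(\alpha)]$ is nontrivial; and $\beta(e)$ is $\beta$-legal for every edge $e$ of $Z\setminus Z_0$; - (b) up to reversal there is at most one indivisible Nielsen path meeting $Z\setminus Z_0$; - (c) every such path is $p=p_1\bar p_2$ with $p_1,p_2$ $\beta$-legal and $L(p_1)=L(p_2)$, where the turn at $v_p=p_1(1)=p_2(1)$ formed by the initial edges of $\bar p_1,\bar p_2$ lies in $Z\setminus Z_0$, is the unique nondegenerate illegal turn in $Z\setminus Z_0$, sits at a vertex of valence $\ge 3$ and degenerates under $D\beta$, and $[\beta(p_i)]=p_i\cdot t$ (no cancellation, $i=1,2$) for a $\beta$-legal path $t$. Let $F$ be a free group with a finite basis and $\phi:F\to F$ an injective endomorphism. For an infinite reduced word $W$ let $W_i$ be its initial segment of length $i$, and let $W\wedge V$ be the longest common initial segment of $W$ and $V$. The word $W$ is *fixed* if $|W\wedge\phi(W_i)|\to\infty$, and an *attracting fixed word* if moreover $|W\wedge\phi(W_i)|-i\to+\infty$. Two fixed infinite words are equivalent if $W'=UW$ with $\phi(U)=U$.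 Fixed points $u,v$ of $\beta$ lie in the same fixed point class if there is a (possibly trivial) path $c$ from $u$ to $v$ with $\beta\circ c\simeq c$ rel endpoints. Let $\mathbf F$ be a nonempty fixed point class of $\beta$, $v_0\in\mathbf F$, $\beta_\pi$ the endomorphism of $\pi_1(Z,v_0)$ induced by $\beta$, and $$\Delta(\mathbf F)=\{e \text{ an oriented edge of } Z\setminus Z_0 \mid e(0)\in\mathbf F,\ D\beta(e)=e\}.$$ Points of $\partial\pi_1(Z,v_0)$ are identified with rays in $Z$ issuing from $v_0$. For $e\in\Delta(\mathbf F)$ let $\mathscr W_e$ be the set of infinite words given by the rays $\lim_{k\to\infty}[c\,\beta^k(e)]$ (that is, $c$ followed by $\beta^\infty(e)=\lim[\beta^k(e)]$, tightened), where $c$ runs over the paths from $v_0$ to $e(0)$ with $\beta\circ c\simeq c$ rel endpoints. An infinite word $W\in\partial\pi_1(Z,v_0)$ *comes from $\beta_0$* if $W=cU$ for some path $c$ from $v_0$ to some $v\in\mathbf F$ with $\beta\circ c\simeq c$ rel endpoints and some attracting fixed word $U\in\partial\pi_1(Z_0,v)$ of the endomorphism of $\pi_1(Z_0,v)$ induced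 by $\beta_0$. (With $v=v_0$ and $c$ trivial these include the attracting fixed words of $(\beta_0)_\pi:\pi_1(Z_0,v_0)\to\pi_1(Z_0,v_0)$.) **Lemma.** Let $\beta:(Z,Z_0)\to(Z,Z_0)$ be an RTT map of Type 3, $\mathbf F$ a nonempty fixed point class of $\beta$ and $v_0\in\mathbf F$. For any choice of finite bases of $\pi_1(Z,v_0)$ and of the groups $\pi_1(Z_0,v)$: 1. For every $e\in\Delta(\mathbf F)$, the set $\mathscr W_e$ is an equivalence class of attracting fixed words of $\beta_\pi$, and no element of $\mathscr W_e$ comes from $\beta_0$. 2. Let $e_1\ne e_2$ be elements of $\Delta(\mathbf F)$. Then $\mathscr W_{e_1}=\mathscr W_{e_2}$ if and only if there is an indivisible Nielsen path $p=p_1\bar p_2$ meeting $Z\setminus Z_0$, decomposed as in (c), such that $e_i$ is the initial edge of $p_i$ for $i=1,2$. 3. Every equivalence class of attracting fixed words of $\beta_\pi$, none of whose elements comes from $\beta_0$, equals $\mathscr W_e$ for some $e\in\Delta(\mathbf F)$. -/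

import Mathlib

open Filter

/-! ### Infinite reduced words and attracting fixed words -/

/-- The inverse of a signed letter (the reverse of an oriented edge). -/
def bar {α : Type*} (x : α × Bool) : α × Bool := (x.1, !x.2)

/-- Infinite reduced words `w₀ w₁ w₂ ⋯` in the letters `α^{±1}`, i.e. the points of the boundary of
`FreeGroup α`. -/
structure InfWord (α : Type*) where
  seq : ℕ → α × Bool
  reduced : ∀ i, seq (i + 1) ≠ bar (seq i)

/-- The initial segment `W_i` of length `i` of the infinite word `W`. -/
def InfWord.trunc {α : Type*} (W : InfWord α) (i : ℕ) : FreeGroup α :=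
  FreeGroup.mk ((List.range i).map W.seq)

/-- The length of the longest common initial segment of an infinite sequence and a list. -/
def commonPrefixLength {β : Type*} [DecidableEq β] : (ℕ → β) → List β → ℕ
  | _, [] => 0
  | s, x :: l => if s 0 = x then commonPrefixLength (fun i => s (i + 1)) l + 1 else 0

/-- `|W ∧ g|`: the length of the longest common initial segment of the infinite reduced word `W`
and the reduced word of `g`. -/
def InfWord.wedge {α : Type*} [DecidableEq α] (W : InfWord α) (g : FreeGroup α) : ℕ :=
  commonPrefixLength W.seq g.toWord

/-- The sequence `g p` of (finite) reduced words converges to the infinite word `W`: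
`|W ∧ g p| → ∞`. -/
def ConvergesTo {α : Type*} [DecidableEq α] (g : ℕ → FreeGroup α) (W : InfWord α) : Prop :=
  Tendsto (fun p => W.wedge (g p)) atTop atTop

section Attracting

variable {G : Type*} [Group G] {n : ℕ}

/-- `W` is an infinite fixed word of `φ`, i.e. the extension `W ↦ lim φ(W_i)` of `φ` to the boundary
fixes `W`. Words are taken with respect to the basis `Λ`. -/
def IsFixedInfWord (Λ : FreeGroupBasis (Fin n) G) (φ : G →* G) (W : InfWord (Fin n)) : Prop :=
  ConvergesTo (fun i => Λ.repr (φ (Λ.repr.symm (W.trunc i)))) W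

/-- `W` is an attracting fixed word of `φ`: it is fixed, and `|W ∧ φ(W_i)| - i → +∞`. -/
def IsAttractingFixedWord (Λ : FreeGroupBasis (Fin n) G) (φ : G →* G) (W : InfWord (Fin n)) :
    Prop :=
  IsFixedInfWord Λ φ W ∧
    Tendsto (fun i : ℕ => (W.wedge (Λ.repr (φ (Λ.repr.symm (W.trunc i)))) : ℤ) - i) atTop atTop

/-- `W' = U W` for some `U` in the fixed subgroup of `φ`. -/
def FixEquiv (Λ : FreeGroupBasis (Fin n) G) (φ : G →* G) (W W' : InfWord (Fin n)) : Prop :=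
  ∃ U : G, φ U = U ∧ ConvergesTo (fun i => Λ.repr U * W.trunc i) W'

/-- The set of equivalence classes of attracting fixed words of `φ`. -/
def attractingClasses (Λ : FreeGroupBasis (Fin n) G) (φ : G →* G) :
    Set (Set (InfWord (Fin n))) :=
  {C | ∃ W, IsAttractingFixedWord Λ φ W ∧
    C = {W' | IsAttractingFixedWord Λ φ W' ∧ FixEquiv Λ φ W W'}}

end Attracting

/-! ### Graphs, edge paths, fundamental groups -/

/-- A graph (one-dimensional cell complex) with vertex set `V` and set of edges `A`; each edge is
given an (arbitrary) reference orientation. The oriented edges are the elements of `A × Bool`: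
`(a, true)` is `a` with its reference orientation, `(a, false)` is its reverse. An edge path, up to
homotopy relative to its endpoints, is recorded by its class in `FreeGroup A`, whose reduced word is
the tightened path. -/
structure CellGraph (V A : Type*) where
  src : A → V
  tgt : A → V

namespace CellGraph

variable {V A : Type*} (Z : CellGraph V A)

/-- The initial vertex of an oriented edge. -/
def init (e : A × Bool) : V := if e.2 then Z.src e.1 else Z.tgt e.1

/-- The terminal vertex of an oriented edge. -/
def term (e : A × Bool) : V := if e.2 then Z.tgt e.1 else Z.src e.1

/-- The list of oriented edges is an edge path (possibly not tight) from `u` to `v`. -/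
def IsWalk : V → List (A × Bool) → V → Prop
  | u, [], v => u = v
  | u, e :: l, v => Z.init e = u ∧ IsWalk (Z.term e) l v

/-- Any two vertices are joined by an edge path. -/
def Connected : Prop := ∀ u v, ∃ l, Z.IsWalk u l v

/-- The valence of a vertex: the number of oriented edges issuing from it. -/
noncomputable def valence (v : V) : ℕ := {e : A × Bool | Z.init e = v}.ncard

theorem IsWalk.append {Z : CellGraph V A} {u v w : V} {l m : List (A × Bool)}
    (h : Z.IsWalk u l v) (h' : Z.IsWalk v m w) : Z.IsWalk u (l ++ m) w := by
  induction l generalizing u with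
  | nil => cases h; exact h'
  | cons e l ih => exact ⟨h.1, ih h.2⟩

theorem init_bar (e : A × Bool) : Z.init (bar e) = Z.term e := by
  obtain ⟨a, b⟩ := e; cases b <;> rfl

theorem term_bar (e : A × Bool) : Z.term (bar e) = Z.init e := by
  obtain ⟨a, b⟩ := e; cases b <;> rfl

theorem IsWalk.invRev {Z : CellGraph V A} {u v : V} {l : List (A × Bool)}
    (h : Z.IsWalk u l v) : Z.IsWalk v (FreeGroup.invRev l) u := by
  induction l generalizing u with
  | nil => cases h; rfl
  | cons e l ih =>
    have h2 : FreeGroup.invRev (e :: l) = FreeGroup.invRev l ++ [bar e] := by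
      simp [FreeGroup.invRev, bar]
    rw [h2]
    exact (ih h.2).append ⟨Z.init_bar e, (Z.term_bar e).trans h.1⟩

/-- The fundamental group at `v` of the subgraph with the same vertices and with edge set `S`:
homotopy classes of closed edge paths at `v` that only use edges in `S`. -/
def pi1 (S : Set A) (v : V) : Subgroup (FreeGroup A) where
  carrier := {g | ∃ l, Z.IsWalk v l v ∧ (∀ x ∈ l, x.1 ∈ S) ∧ FreeGroup.mk l = g}
  one_mem' := ⟨[], rfl, by simp, rfl⟩
  mul_mem' := by
    rintro _ _ ⟨l, h, hS, rfl⟩ ⟨m, h', hS', rfl⟩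
    refine ⟨l ++ m, h.append h', ?_, by simp⟩
    intro x hx
    rcases List.mem_append.1 hx with hx | hx
    · exact hS x hx
    · exact hS' x hx
  inv_mem' := by
    rintro _ ⟨l, h, hS, rfl⟩
    refine ⟨FreeGroup.invRev l, h.invRev, ?_, by simp⟩
    intro x hx
    simp only [FreeGroup.invRev, List.mem_reverse, List.mem_map] at hx
    obtain ⟨y, hy, rfl⟩ := hx
    exact hS y hy

variable [DecidableEq A]

/-- The reduced word of `g` is a (tight, possibly trivial) path from `u` to `v`. -/
def IsPath (u : V) (g : FreeGroup A) (v : V) : Prop := Z.IsWalk u g.toWord v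

/-- Transport of loops in a subgraph at `v` to loops at `u` along a path `c` from `u` to `v`:
`g ↦ c g c⁻¹`. -/
def transport (S : Set A) {u v : V} {c : FreeGroup A} (hc : Z.IsPath u c v) :
    Z.pi1 S v →* Z.pi1 Set.univ u :=
  (((MulAut.conj c).toMonoidHom).comp (Z.pi1 S v).subtype).codRestrict _ (by
    rintro ⟨_, l, h, -, rfl⟩
    refine ⟨c.toWord ++ (l ++ FreeGroup.invRev c.toWord),
      IsWalk.append hc (h.append (IsWalk.invRev hc)), by simp, ?_⟩
    simp only [MonoidHom.comp_apply, Subgroup.coe_subtype, MulEquiv.coe_toMonoidHom,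
      MulAut.conj_apply]
    rw [← FreeGroup.mul_mk, ← FreeGroup.mul_mk, ← FreeGroup.inv_mk, FreeGroup.mk_toWord, mul_assoc])

end CellGraph

/-! ### Graph maps -/

/-- A cellular selfmap of a graph: vertices go to vertices and each edge goes to a tight, possibly
trivial, edge path. The map is recorded up to reparametrization inside the edges. -/
structure GraphMap {V A : Type*} [DecidableEq A] (Z : CellGraph V A) where
  onV : V → V
  onE : A → FreeGroup A
  isPath : ∀ a, Z.IsPath (onV (Z.src a)) (onE a) (onV (Z.tgt a))

namespace GraphMap

variable {V A : Type*} [DecidableEq A] {Z : CellGraph V A} (β : GraphMap Z)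

/-- The map `σ ↦ [β(σ)]` on homotopy classes of edge paths. -/
def hom : FreeGroup A →* FreeGroup A := FreeGroup.lift β.onE

/-- The subgraph with edge set `S` (and all vertices) is mapped into itself. -/
def Invariant (S : Set A) : Prop := ∀ a ∈ S, ∀ x ∈ (β.onE a).toWord, x.1 ∈ S

theorem invariant_univ : β.Invariant Set.univ := fun _ _ _ _ => Set.mem_univ _

theorem exists_walk {S : Set A} (hS : β.Invariant S) {u v : V} {l : List (A × Bool)}
    (h : Z.IsWalk u l v) (hl : ∀ x ∈ l, x.1 ∈ S) :
    ∃ m, Z.IsWalk (β.onV u) m (β.onV v) ∧ (∀ x ∈ m, x.1 ∈ S) ∧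
      FreeGroup.mk m = β.hom (FreeGroup.mk l) := by
  induction l generalizing u with
  | nil => cases h; exact ⟨[], rfl, by simp, by rw [← FreeGroup.one_eq_mk, map_one]⟩
  | cons e l ih =>
    obtain ⟨m, hm, hmS, hme⟩ := ih h.2 fun x hx => hl x (List.mem_cons_of_mem _ hx)
    have he : ∃ k, Z.IsWalk (β.onV (Z.init e)) k (β.onV (Z.term e)) ∧ (∀ x ∈ k, x.1 ∈ S) ∧
        FreeGroup.mk k = β.hom (FreeGroup.mk [e]) := by
      have haS := hS e.1 (hl e List.mem_cons_self)
      obtain ⟨a, b⟩ := e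
      cases b
      · refine ⟨FreeGroup.invRev (β.onE a).toWord, (β.isPath a).invRev, ?_, ?_⟩
        · intro x hx
          simp only [FreeGroup.invRev, List.mem_reverse, List.mem_map] at hx
          obtain ⟨y, hy, rfl⟩ := hx
          exact haS y hy
        · rw [← FreeGroup.inv_mk, FreeGroup.mk_toWord]
          simp [hom]
      · refine ⟨(β.onE a).toWord, β.isPath a, haS, ?_⟩
        rw [FreeGroup.mk_toWord]
        simp [hom]
    obtain ⟨k, hk, hkS, hke⟩ := he
    refine ⟨k ++ m, (h.1 ▸ hk).append hm, ?_, ?_⟩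
    · intro x hx
      rcases List.mem_append.1 hx with hx | hx
      · exact hkS x hx
      · exact hmS x hx
    · rw [← FreeGroup.mul_mk, hke, hme, ← map_mul, FreeGroup.mul_mk]
      rfl

/-- The endomorphism induced by `β` on the fundamental group, at a fixed vertex `v`, of the
invariant subgraph with edge set `S`. -/
def induced {S : Set A} (hS : β.Invariant S) {v : V} (hv : β.onV v = v) :
    Z.pi1 S v →* Z.pi1 S v :=
  (β.hom.comp (Z.pi1 S v).subtype).codRestrict _ (by
    rintro ⟨_, l, h, hl, rfl⟩
    obtain ⟨m, hm, hmS, hme⟩ := β.exists_walk hS h hl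
    rw [hv] at hm
    exact ⟨m, hm, hmS, hme⟩)

/-- `D β (e)`: the first oriented edge of `β(e)`, or `none` if `β(e)` is trivial. -/
def D (e : A × Bool) : Option (A × Bool) := (β.hom (FreeGroup.mk [e])).toWord.head?

/-- The turn formed by two oriented edges issuing from the same vertex is illegal: some iterate of
`D β` makes it degenerate. -/
def IllegalTurn (e₁ e₂ : A × Bool) : Prop :=
  Z.init e₁ = Z.init e₂ ∧
    ∃ k : ℕ, (fun o => Option.bind o β.D)^[k] (some e₁) = (fun o => Option.bind o β.D)^[k] (some e₂)

/-- A tight path is `β`-legal (relative to the subgraph with edge set `S₀`) if it has no illegal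
turn consisting of two edges outside `S₀`. -/
def IsLegal (S₀ : Set A) (g : FreeGroup A) : Prop :=
  ∀ l x y m, g.toWord = l ++ x :: y :: m → x.1 ∉ S₀ → y.1 ∉ S₀ → ¬ β.IllegalTurn (bar x) y

/-- `c` is a path from the fixed vertex `u` to the fixed vertex `v`, possibly trivial, with
`β ∘ c ≃ c` relative to the endpoints. -/
def Connects (c : FreeGroup A) (u v : V) : Prop :=
  β.onV u = u ∧ β.onV v = v ∧ Z.IsPath u c v ∧ β.hom c = c

/-- `F` is a nonempty fixed point class of `β` (for a map all of whose fixed points are vertices). -/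
def IsFixedPointClass (F : Set V) : Prop :=
  ∃ u, β.onV u = u ∧ F = {v | ∃ c, β.Connects c u v}

/-- `β`-Nielsen paths: nontrivial paths `p` between fixed points with `β ∘ p ≃ p` relative to the
endpoints. -/
def IsNielsen (p : FreeGroup A) : Prop := p ≠ 1 ∧ ∃ u v, β.Connects p u v

/-- Indivisible Nielsen paths: those that are not a concatenation of two Nielsen paths. -/
def IsIndivisibleNielsen (p : FreeGroup A) : Prop :=
  β.IsNielsen p ∧ ¬ ∃ p₁ p₂, β.IsNielsen p₁ ∧ β.IsNielsen p₂ ∧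
    p.toWord = p₁.toWord ++ p₂.toWord

end GraphMap

/-- The path `p` contains an edge outside the subgraph with edge set `S₀`. -/
def MeetsCompl {A : Type*} [DecidableEq A] (S₀ : Set A) (p : FreeGroup A) : Prop :=
  ∃ x ∈ p.toWord, x.1 ∉ S₀

/-- The length of a tight path for a length function on the edges. -/
def pathLength {A : Type*} [DecidableEq A] (L : A → ℝ) (p : FreeGroup A) : ℝ :=
  (p.toWord.map fun x => L x.1).sum

/-- `p = p₁ p̄₂`, where `p₁` and `p₂` are `β`-legal of the same length, their last edges `x`, `y` lie
outside `S₀`, the turn `{x̄, ȳ}` is the only (nondegenerate) illegal turn outside `S₀`, it sits at a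
vertex of valence at least `3` and degenerates under `D β`, and `[β(p₁)] = p₁ t`, `[β(p₂)] = p₂ t`
for a `β`-legal path `t`. -/
def IsLegalHalves {V A : Type*} [DecidableEq A] {Z : CellGraph V A} (β : GraphMap Z) (S₀ : Set A)
    (L : A → ℝ) (p p₁ p₂ : FreeGroup A) : Prop :=
  p.toWord = p₁.toWord ++ p₂⁻¹.toWord ∧
  β.IsLegal S₀ p₁ ∧ β.IsLegal S₀ p₂ ∧
  pathLength L p₁ = pathLength L p₂ ∧
  (∃ x y : A × Bool, p₁.toWord.getLast? = some x ∧ p₂.toWord.getLast? = some y ∧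
    x.1 ∉ S₀ ∧ y.1 ∉ S₀ ∧ x ≠ y ∧
    3 ≤ Z.valence (Z.term x) ∧
    β.D (bar x) = β.D (bar y) ∧
    ∀ x' y' : A × Bool, x'.1 ∉ S₀ → y'.1 ∉ S₀ → x' ≠ y' → β.IllegalTurn x' y' →
      (x' = bar x ∧ y' = bar y) ∨ (x' = bar y ∧ y' = bar x)) ∧
  ∃ t : FreeGroup A, β.IsLegal S₀ t ∧
    (β.hom p₁).toWord = p₁.toWord ++ t.toWord ∧ (β.hom p₂).toWord = p₂.toWord ++ t.toWord

/-- The properties common to all relative train track maps `β : (Z, Z₀) → (Z, Z₀)`, where `Z₀` is the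
subgraph with edge set `S₀` containing all vertices. -/
structure IsRTTPair {V A : Type*} [DecidableEq A] {Z : CellGraph V A} (β : GraphMap Z)
    (S₀ : Set A) : Prop where
  connected : Z.Connected
  valence_ne_one : ∀ v, Z.valence v ≠ 1
  pi1_injective : ∀ v, ∀ g ∈ Z.pi1 Set.univ v, β.hom g = 1 → g = 1
  /-- No point in the interior of an edge is fixed. In terms of edge paths: the path `β(a)` does not
  cross `a`, except possibly as its first or its last edge and then in the positive direction. (Any
  other crossing forces an interior fixed point; these ones do not.) -/
  fixed_points_vertices : ∀ a l x m, (β.onE a).toWord = l ++ x :: m → x.1 = a →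
    x = (a, true) ∧ (l = [] ∨ m = [])
  invariant : β.Invariant S₀
  proper : S₀ ≠ Set.univ

/-- A relative train track map of Type 3 (the exponentially expanding type), together with its
metric `L` and its expansion factor. -/
structure Type3RTT {V A : Type*} [DecidableEq A] {Z : CellGraph V A} (β : GraphMap Z)
    (S₀ : Set A) where
  isRTTPair : IsRTTPair β S₀
  /-- the non-negative metric, supported on the edges outside `S₀` -/
  L : A → ℝ
  /-- the expansion factor -/
  factor : ℝ
  one_lt_factor : 1 < factor
  L_eq_zero : ∀ a ∈ S₀, L a = 0
  L_pos : ∀ a, a ∉ S₀ → 0 < L a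
  expands : ∀ a, a ∉ S₀ → pathLength L (β.onE a) = factor * L a
  /-- property (a), the first of the three relative train track conditions of Bestvina and Handel -/
  D_mem : ∀ e : A × Bool, e.1 ∉ S₀ → ∃ e', β.D e = some e' ∧ e'.1 ∉ S₀
  /-- the second relative train track condition: a nontrivial path in `Z₀` between endpoints of edges
  outside `Z₀` has a nontrivial image -/
  hom_ne_one : ∀ (α : FreeGroup A) (u v : V), α ≠ 1 → Z.IsPath u α v → (∀ x ∈ α.toWord, x.1 ∈ S₀) →
    (∃ e : A × Bool, e.1 ∉ S₀ ∧ Z.init e = u) → (∃ e : A × Bool, e.1 ∉ S₀ ∧ Z.init e = v) →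
    β.hom α ≠ 1
  /-- the third relative train track condition: the image of an edge outside `Z₀` is legal (hence, as
  `D β` maps legal turns to legal turns, so is the image of each legal path outside `Z₀`) -/
  legal : ∀ a, a ∉ S₀ → β.IsLegal S₀ (β.onE a)
  /-- property (b): uniqueness, up to the direction of travel -/
  unique_nielsen : ∀ p q : FreeGroup A, β.IsIndivisibleNielsen p → MeetsCompl S₀ p →
    β.IsIndivisibleNielsen q → MeetsCompl S₀ q → q = p ∨ q = p⁻¹
  /-- property (c) -/
  nielsen_form : ∀ p : FreeGroup A, β.IsIndivisibleNielsen p → MeetsCompl S₀ p →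
    ∃ p₁ p₂, IsLegalHalves β S₀ L p p₁ p₂

section Classes

variable {V A : Type*} [DecidableEq A] {Z : CellGraph V A} (β : GraphMap Z)

/-- `Δ(F)`: the oriented edges outside `S₀` that issue from a point of `F` and are initially expanded
along themselves. -/
def Delta (S₀ : Set A) (F : Set V) : Set (A × Bool) :=
  {e | e.1 ∉ S₀ ∧ Z.init e ∈ F ∧ β.D e = some e}

/-- The set `𝒲_e` of infinite words attached to `e`. A path `c` from `v₀` to the origin of `e` with
`β ∘ c ≃ c` gives a point `ṽ` of the universal cover fixed by the lift `β̃` of `β` that fixes `ṽ₀`.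
The lift from `ṽ` of the ray `β^∞(e) = lim [β^k(e)]`, seen from `ṽ₀`, is the ray
`ρ = lim [c β^k(e)]`, and `W` belongs to `𝒲_e` if it corresponds, for some `c`, to the end of the
universal cover given by `ρ`, i.e. if the loops `W_i` at `v₀` converge to `ρ`. -/
def edgeClass {v₀ : V} {n : ℕ} (Λ : FreeGroupBasis (Fin n) (Z.pi1 Set.univ v₀)) (e : A × Bool) :
    Set (InfWord (Fin n)) :=
  {W | ∃ c : FreeGroup A, β.Connects c v₀ (Z.init e) ∧ ∃ ρ : InfWord A,
    ConvergesTo (fun k => c * (β.hom)^[k] (FreeGroup.mk [e])) ρ ∧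
    ConvergesTo (fun i => ((Λ.repr.symm (W.trunc i) : Z.pi1 Set.univ v₀) : FreeGroup A)) ρ}

/-- The infinite word `W` at `v₀` comes from an attracting fixed word of the restriction `β₀` of `β`
to the invariant subgraph with edge set `S₀`: there are a fixed vertex `v`, a path `c` from `v₀` to
`v` with `β ∘ c ≃ c` (so that `v` is in the fixed point class of `v₀`) and an attracting fixed word
`U` of the endomorphism of `π₁(Z₀, v)` induced by `β₀` such that `W = c U`. -/
def ComesFrom {S₀ : Set A} (hS₀ : β.Invariant S₀) {v₀ : V} {n : ℕ}
    (Λ : FreeGroupBasis (Fin n) (Z.pi1 Set.univ v₀))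
    {n₀ : V → ℕ} (Λ₀ : ∀ v, FreeGroupBasis (Fin (n₀ v)) (Z.pi1 S₀ v))
    (W : InfWord (Fin n)) : Prop :=
  ∃ (v : V) (c : FreeGroup A) (hc : β.Connects c v₀ v) (U : InfWord (Fin (n₀ v))),
    IsAttractingFixedWord (Λ₀ v) (β.induced hS₀ hc.2.1) U ∧
    ConvergesTo
      (fun i => Λ.repr (Z.transport S₀ hc.2.2.1 ((Λ₀ v).repr.symm (U.trunc i)))) W

end Classes

/-! Edge paths up to homotopy are reduced words in the edges, so the argument takes place in the
Cayley tree of `FreeGroup A`, where the distance from g to h is `(g⁻¹ * h).norm`. A finite basis of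
a fundamental group gives a map between Cayley trees that is Lipschitz, proper and has bounded
cancellation (`exists_isQuasiEmbedding`). It therefore identifies infinite words with rays issuing
from the base vertex, and turns attracting fixed words into rays satisfying `IsAttractingRay β.hom`.
The latter notion involves no basis and is invariant under translation by a path fixed by β.

Part 1 rests on legality. In the image of a legal path nothing cancels at an edge outside `S₀`, and
the length L is multiplied by λ > 1. If Dβ(e) = e, the paths β^k(e) are thus nested and converge to
a ray along which every point moves ahead, by an amount tending to infinity: the ray is attracting.
Its L-length is infinite, whereas words coming from `S₀` have bounded L-length.

Part 2: if c₁β^∞(e₁) = c₂β^∞(e₂), then p = c₁⁻¹c₂ is fixed, runs along the first ray and returns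
along the second. No nontrivial initial segment of such a ray is fixed, so p is indivisible and
property (c) applies. Conversely p₁ = p·p₂ gives β^k(p₁) = p·β^k(p₂), and the limits are the two
rays.

Part 3 is a discrete intermediate value argument (`IsAttractingRay.exists_fixed_point`). On an
attracting ray take the last vertex that is not moved ahead. As no interior point of an edge is
fixed, this vertex is fixed and the next edge e satisfies Dβ(e) = e. Beyond it everything moves
ahead, so the tail is determined by e: it stays in `S₀` if e does, and otherwise it is β^∞(e). -/

namespace FreeGroup

/-! ### Reduced words and the metric of the Cayley tree. -/

variable {α : Type*}

theorem isReduced_iff_isChain_bar {l : List (α × Bool)} :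
    IsReduced l ↔ l.IsChain fun x y => y ≠ bar x := by
  have : (fun x y : α × Bool => x.1 = y.1 → x.2 = y.2) = fun x y => y ≠ bar x := by
    ext ⟨a, b⟩ ⟨c, d⟩
    simp only [bar, ne_eq, Prod.mk.injEq, not_and]
    cases b <;> cases d <;> simp [eq_comm]
  rw [← this]; rfl

theorem invRev_append_singleton (l : List (α × Bool)) (x : α × Bool) :
    invRev (l ++ [x]) = bar x :: invRev l := by
  simp [invRev, bar]

theorem invRev_cons_eq (l : List (α × Bool)) (x : α × Bool) :
    invRev (x :: l) = invRev l ++ [bar x] := by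
  simp [invRev, bar]

@[simp] theorem bar_bar (x : α × Bool) : bar (bar x) = x := by simp [bar]

theorem mem_invRev {l : List (α × Bool)} {x : α × Bool} : x ∈ invRev l ↔ bar x ∈ l := by
  simp only [invRev, List.mem_reverse, List.mem_map]
  constructor
  · rintro ⟨y, hy, rfl⟩; simpa [bar] using hy
  · intro h; exact ⟨bar x, h, by simp [bar]⟩

theorem head?_invRev (l : List (α × Bool)) : (invRev l).head? = l.getLast?.map bar := by
  simp [invRev]; rfl

theorem getLast?_invRev (l : List (α × Bool)) : (invRev l).getLast? = l.head?.map bar := by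
  simp [invRev]; rfl

theorem isChain_invRev {R : α × Bool → α × Bool → Prop} (hR : ∀ x y, R x y → R (bar y) (bar x))
    {l : List (α × Bool)} (h : l.IsChain R) : (invRev l).IsChain R := by
  rw [invRev, List.isChain_reverse, List.isChain_map]
  exact h.imp fun x y hxy => hR x y hxy

theorem isReduced_append {l m : List (α × Bool)} (hl : IsReduced l) (hm : IsReduced m)
    (h : ∀ x ∈ l.getLast?, ∀ y ∈ m.head?, y ≠ bar x) : IsReduced (l ++ m) := by
  rw [isReduced_iff_isChain_bar] at *
  exact List.isChain_append.2 ⟨hl, hm, h⟩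

theorem isReduced_left {l m : List (α × Bool)} (h : IsReduced (l ++ m)) : IsReduced l :=
  List.IsChain.left_of_append h

theorem isReduced_right {l m : List (α × Bool)} (h : IsReduced (l ++ m)) : IsReduced m :=
  List.IsChain.right_of_append h

variable [DecidableEq α]

theorem IsReduced.toWord_mk {l : List (α × Bool)} (h : IsReduced l) : (mk l).toWord = l := by
  rw [FreeGroup.toWord_mk, h.reduce_eq]

theorem IsReduced.invRev' {l : List (α × Bool)} (h : IsReduced l) :
    IsReduced (FreeGroup.invRev l) := by
  rw [← h.toWord_mk, ← toWord_inv]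
  exact isReduced_toWord

theorem toWord_mul_of_isReduced {g h : FreeGroup α} (H : IsReduced (g.toWord ++ h.toWord)) :
    (g * h).toWord = g.toWord ++ h.toWord := by
  rw [toWord_mul, H.reduce_eq]

theorem eq_mul_of_toWord {g a b : FreeGroup α} (h : g.toWord = a.toWord ++ b.toWord) :
    g = a * b := by
  rw [← mk_toWord (x := g), h, ← mul_mk, mk_toWord, mk_toWord]

/-- The reduced word of `g⁻¹ h` when the reduced words of `g` and `h` part after `l`. -/
theorem toWord_inv_mul {g h : FreeGroup α} {l r s : List (α × Bool)} (hg : g.toWord = l ++ r)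
    (hh : h.toWord = l ++ s) (H : ∀ x ∈ r.head?, ∀ y ∈ s.head?, x ≠ y) :
    (g⁻¹ * h).toWord = invRev r ++ s := by
  have e : g⁻¹ * h = mk (invRev r ++ s) := by
    rw [← mk_toWord (x := g), ← mk_toWord (x := h), hg, hh, ← mul_mk, ← mul_mk, ← mul_mk, ← inv_mk]
    group
  have hr : IsReduced r := isReduced_right (hg ▸ isReduced_toWord)
  have hs : IsReduced s := isReduced_right (hh ▸ isReduced_toWord)
  rw [e, IsReduced.toWord_mk]
  refine isReduced_append hr.invRev' hs fun x hx y hy => ?_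
  rw [getLast?_invRev] at hx
  obtain ⟨z, hz, rfl⟩ := Option.mem_map.1 hx
  rw [bar_bar]
  exact (H z hz y hy).symm

theorem exists_common_prefix {γ : Type*} [DecidableEq γ] (u v : List γ) :
    ∃ l r s, u = l ++ r ∧ v = l ++ s ∧ ∀ x ∈ r.head?, ∀ y ∈ s.head?, x ≠ y := by
  induction u generalizing v with
  | nil => exact ⟨[], [], v, rfl, rfl, by simp⟩
  | cons a u ih =>
    cases v with
    | nil => exact ⟨[], a :: u, [], rfl, rfl, by simp⟩
    | cons b v =>
      by_cases hab : a = b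
      · subst hab
        obtain ⟨l, r, s, rfl, rfl, H⟩ := ih v
        exact ⟨a :: l, r, s, rfl, rfl, H⟩
      · exact ⟨[], a :: u, b :: v, rfl, rfl, by simpa using hab⟩

theorem norm_inv_mul_comm (g h : FreeGroup α) : (g⁻¹ * h).norm = (h⁻¹ * g).norm := by
  rw [← norm_inv_eq]; simp

theorem norm_inv_mul_le (g k h : FreeGroup α) :
    (g⁻¹ * h).norm ≤ (g⁻¹ * k).norm + (k⁻¹ * h).norm := by
  simpa [mul_assoc] using norm_mul_le (g⁻¹ * k) (k⁻¹ * h)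

theorem norm_le_add (g h : FreeGroup α) : h.norm ≤ g.norm + (g⁻¹ * h).norm := by
  simpa using norm_mul_le g (g⁻¹ * h)

theorem norm_le_add' (g h : FreeGroup α) : h.norm ≤ g.norm + (h⁻¹ * g).norm := by
  rw [norm_inv_mul_comm]; exact norm_le_add g h

/-- The median of `1`, `g`, `h`: the tripod spanned by these points. -/
theorem exists_meet (g h : FreeGroup α) : ∃ w : FreeGroup α, w.toWord <+: g.toWord ∧
    w.toWord <+: h.toWord ∧ g.norm = w.norm + (w⁻¹ * g).norm ∧
    h.norm = w.norm + (w⁻¹ * h).norm ∧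
    (g⁻¹ * h).norm = (g⁻¹ * w).norm + (w⁻¹ * h).norm := by
  obtain ⟨l, r, s, hg, hh, H⟩ := exists_common_prefix g.toWord h.toWord
  have hl : IsReduced l := isReduced_left (hg ▸ isReduced_toWord)
  have hw := hl.toWord_mk
  have h1 : ((mk l)⁻¹ * g).toWord = r := by
    simpa using toWord_inv_mul (r := []) (hw.trans (List.append_nil l).symm) hg (by simp)
  have h2 : ((mk l)⁻¹ * h).toWord = s := by
    simpa using toWord_inv_mul (r := []) (hw.trans (List.append_nil l).symm) hh (by simp)
  have h3 := toWord_inv_mul hg hh H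
  refine ⟨mk l, ⟨r, by rw [hw, hg]⟩, ⟨s, by rw [hw, hh]⟩, ?_, ?_, ?_⟩
  · rw [norm, norm, norm, h1, hw, hg, List.length_append]
  · rw [norm, norm, norm, h2, hw, hh, List.length_append]
  · rw [norm_inv_mul_comm g (mk l), norm, norm, norm, h1, h2, h3, List.length_append, invRev_length]

/-- A path leading from outside the shadow of `w` into it passes through `w`. -/
theorem norm_inv_mul_of_prefix {w x y : FreeGroup α} (hy : w.toWord <+: y.toWord)
    (hx : ¬ w.toWord <+: x.toWord) :
    (x⁻¹ * y).norm = (x⁻¹ * w).norm + (w⁻¹ * y).norm := by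
  obtain ⟨l, r, s, hxl, hwl, H⟩ := exists_common_prefix x.toWord w.toWord
  obtain ⟨t, ht⟩ := hy
  have hs : s ≠ [] := by
    rintro rfl
    exact hx ⟨r, by rw [hwl, hxl]; simp⟩
  obtain ⟨a, s', rfl⟩ := List.exists_cons_of_ne_nil hs
  have h1 := toWord_inv_mul hxl hwl H
  have h2 : (x⁻¹ * y).toWord = invRev r ++ (a :: s' ++ t) :=
    toWord_inv_mul hxl (by rw [← ht, hwl, List.append_assoc]) (by simpa using H)
  have h3 : (w⁻¹ * y).toWord = t := by
    simpa using toWord_inv_mul (r := []) (List.append_nil w.toWord).symm ht.symm (by simp)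
  simp only [norm, h1, h2, h3, List.length_append]
  omega

theorem norm_of_prefix {w g : FreeGroup α} (h : w.toWord <+: g.toWord) :
    g.norm = w.norm + (w⁻¹ * g).norm := by
  obtain ⟨t, ht⟩ := h
  have h3 : (w⁻¹ * g).toWord = t := by
    simpa using toWord_inv_mul (r := []) (List.append_nil w.toWord).symm ht.symm (by simp)
  simp [norm, h3, ← ht]

theorem toWord_inv_mul_of_prefix {w g : FreeGroup α} {t : List (α × Bool)}
    (h : g.toWord = w.toWord ++ t) : (w⁻¹ * g).toWord = t := by
  simpa using toWord_inv_mul (r := []) (List.append_nil w.toWord).symm h (by simp)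

/-- The hypothesis says that the Gromov product of g and h, based at 1, is at least m. -/
theorem take_toWord_eq {g h : FreeGroup α} {m : ℕ}
    (H : (g⁻¹ * h).norm + 2 * m ≤ g.norm + h.norm) :
    m ≤ g.norm ∧ g.toWord.take m = h.toWord.take m := by
  obtain ⟨l, r, s, hg, hh, hrs⟩ := exists_common_prefix g.toWord h.toWord
  have h3 := toWord_inv_mul hg hh hrs
  simp only [norm, h3, hg, hh, List.length_append, invRev_length] at H ⊢
  have : m ≤ l.length := by omega
  refine ⟨by omega, ?_⟩
  rw [List.take_append_of_le_length this, List.take_append_of_le_length this]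

end FreeGroup


section Development

open FreeGroup CellGraph

/-! ### Rays in the Cayley tree and convergence to the boundary. -/

section Rays

variable {α : Type*}

theorem InfWord.isReduced_range (W : InfWord α) (i : ℕ) :
    IsReduced ((List.range i).map W.seq) := by
  rw [isReduced_iff_isChain_bar, List.isChain_iff_getElem]
  intro j hj
  simpa using W.reduced j

theorem InfWord.ext' {W W' : InfWord α} (h : ∀ i, W.seq i = W'.seq i) : W = W' := by
  cases W; cases W'; congr; exact funext h

variable [DecidableEq α]

theorem InfWord.toWord_trunc (W : InfWord α) (i : ℕ) :
    (W.trunc i).toWord = (List.range i).map W.seq :=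
  (W.isReduced_range i).toWord_mk

@[simp] theorem InfWord.norm_trunc (W : InfWord α) (i : ℕ) : (W.trunc i).norm = i := by
  simp [FreeGroup.norm, W.toWord_trunc]

theorem le_commonPrefixLength_iff {γ : Type*} [DecidableEq γ] (s : ℕ → γ) (l : List γ) (m : ℕ) :
    m ≤ commonPrefixLength s l ↔ (List.range m).map s <+: l := by
  induction l generalizing s m with
  | nil => simp [commonPrefixLength]
  | cons x l ih =>
    cases m with
    | zero => simp
    | succ m =>
      rw [List.range_succ_eq_map, List.map_cons, List.map_map, List.cons_prefix_cons]
      unfold commonPrefixLength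
      split_ifs with h
      · rw [Nat.add_le_add_iff_right, ih]; simp [h, Function.comp_def]
      · simp [h]

theorem InfWord.le_wedge_iff {W : InfWord α} {g : FreeGroup α} {m : ℕ} :
    m ≤ W.wedge g ↔ (W.trunc m).toWord <+: g.toWord := by
  rw [W.toWord_trunc]; exact le_commonPrefixLength_iff _ _ _

theorem InfWord.wedge_le_norm (W : InfWord α) (g : FreeGroup α) : W.wedge g ≤ g.norm := by
  have := (InfWord.le_wedge_iff.1 (le_refl (W.wedge g))).length_le
  simpa [W.toWord_trunc, FreeGroup.norm] using this

theorem InfWord.trunc_prefix_trunc (W : InfWord α) {i j : ℕ} (h : i ≤ j) :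
    (W.trunc i).toWord <+: (W.trunc j).toWord := by
  rw [W.toWord_trunc, W.toWord_trunc]
  obtain ⟨k, rfl⟩ := Nat.exists_eq_add_of_le h
  rw [List.range_add, List.map_append]
  exact List.prefix_append _ _

theorem InfWord.trunc_inv_mul (W : InfWord α) {i j : ℕ} (h : i ≤ j) :
    ((W.trunc i)⁻¹ * W.trunc j).norm = j - i := by
  have := norm_of_prefix (W.trunc_prefix_trunc h)
  simp at this; omega

@[simp] theorem InfWord.wedge_trunc (W : InfWord α) (i : ℕ) : W.wedge (W.trunc i) = i :=
  le_antisymm (by simpa using W.wedge_le_norm (W.trunc i)) (InfWord.le_wedge_iff.2 (by simp))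

theorem InfWord.norm_trunc_inv_mul {W : InfWord α} {g : FreeGroup α} {i : ℕ} (h : i ≤ W.wedge g) :
    g.norm = i + ((W.trunc i)⁻¹ * g).norm := by
  simpa using norm_of_prefix (InfWord.le_wedge_iff.1 h)

/-- If `g` follows `W` longer than `x` does, then the tripod `1, x, g` has its centre on `W`. -/
theorem InfWord.norm_inv_mul_of_wedge_lt {W : InfWord α} {x g : FreeGroup α}
    (h : W.wedge x < W.wedge g) : (x⁻¹ * g).norm + 2 * W.wedge x = x.norm + g.norm := by
  have hx : ¬ (W.trunc (W.wedge x + 1)).toWord <+: x.toWord := by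
    rw [← InfWord.le_wedge_iff]; omega
  have hg : (W.trunc (W.wedge x + 1)).toWord <+: g.toWord := by
    rw [← InfWord.le_wedge_iff]; omega
  have h1 := norm_inv_mul_of_prefix hg hx
  have h2 := InfWord.norm_trunc_inv_mul (W := W) (g := g) (i := W.wedge x + 1) (by omega)
  obtain ⟨l, hl⟩ := InfWord.le_wedge_iff.1 (le_refl (W.wedge x))
  have h3 : (x⁻¹ * W.trunc (W.wedge x + 1)).toWord = invRev l ++ [W.seq (W.wedge x)] := by
    refine toWord_inv_mul (l := (W.trunc (W.wedge x)).toWord) hl.symm ?_ ?_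
    · rw [W.toWord_trunc, W.toWord_trunc, List.range_succ, List.map_append]; rfl
    · rintro a ha b hb rfl
      refine hx ?_
      cases l with
      | nil => simp at ha
      | cons c l =>
        simp at ha hb
        rw [W.toWord_trunc, List.range_succ, List.map_append, ← hl, ← W.toWord_trunc]
        refine ⟨l, ?_⟩
        simp [hb, ha]
  have h4 : (x⁻¹ * W.trunc (W.wedge x + 1)).norm = l.length + 1 := by simp [FreeGroup.norm, h3]
  have h5 : x.norm = W.wedge x + l.length := by
    have := congrArg List.length hl
    simpa [FreeGroup.norm, W.toWord_trunc] using this.symm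
  omega

/-- If g follows W further than h does, the path from h to g has to cover the part of W between the
two branch points. -/
theorem InfWord.wedge_le_add (W : InfWord α) (g h : FreeGroup α) :
    W.wedge g ≤ W.wedge h + (g⁻¹ * h).norm := by
  by_contra! H
  have h1 := InfWord.norm_inv_mul_of_wedge_lt (W := W) (x := h) (g := g) (by omega)
  have := norm_inv_mul_comm g h
  have := W.wedge_le_norm h
  have := W.wedge_le_norm g
  omega

theorem convergesTo_iff {g : ℕ → FreeGroup α} {W : InfWord α} :
    ConvergesTo g W ↔ ∀ m, ∀ᶠ p in atTop, m ≤ W.wedge (g p) := tendsto_atTop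

theorem convergesTo_trunc (W : InfWord α) : ConvergesTo W.trunc W := by
  unfold ConvergesTo; simpa using! tendsto_id

theorem ConvergesTo.unique {g : ℕ → FreeGroup α} {W W' : InfWord α} (h : ConvergesTo g W)
    (h' : ConvergesTo g W') : W = W' := by
  refine InfWord.ext' fun i => ?_
  obtain ⟨p, hp, hp'⟩ := ((convergesTo_iff.1 h (i + 1)).and (convergesTo_iff.1 h' (i + 1))).exists
  rw [InfWord.le_wedge_iff] at hp hp'
  have := List.prefix_of_prefix_length_le hp hp' (by simp [InfWord.toWord_trunc])
  have := this.eq_of_length (by simp [InfWord.toWord_trunc])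
  rw [InfWord.toWord_trunc, InfWord.toWord_trunc, List.map_inj_left] at this
  exact this i (by simp)

theorem ConvergesTo.of_norm_le {g h : ℕ → FreeGroup α} {W : InfWord α} (H : ConvergesTo g W)
    (C : ℕ) (hC : ∀ i, ((g i)⁻¹ * h i).norm ≤ C) : ConvergesTo h W := by
  rw [convergesTo_iff] at *
  intro m
  filter_upwards [H (m + C)] with p hp
  have := W.wedge_le_add (g p) (h p)
  have := hC p
  omega

/-- Convergence criterion: Gromov products tend to infinity. -/
theorem exists_convergesTo {g : ℕ → FreeGroup α}
    (H : ∀ m, ∃ N, ∀ j ≥ N, ∀ k ≥ j, ((g j)⁻¹ * g k).norm + 2 * m ≤ (g j).norm + (g k).norm) :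
    ∃ W, ConvergesTo g W := by
  choose N hN using H
  have key : ∀ m, ∀ k ≥ N m, m ≤ (g k).norm ∧ (g k).toWord.take m = (g (N m)).toWord.take m := by
    intro m k hk
    have h1 := take_toWord_eq (hN m (N m) le_rfl k hk)
    have h2 := take_toWord_eq (hN m k hk k le_rfl)
    exact ⟨h2.1, h1.2.symm⟩
  have hlt : ∀ i k, k ≥ N (i + 1) → i < (g k).toWord.length := fun i k hk =>
    (key (i + 1) k hk).1
  let s : ℕ → α × Bool := fun i => (g (N (i + 1))).toWord[i]'(hlt i _ le_rfl)
  have hs : ∀ i k (hk : k ≥ N (i + 1)), (g k).toWord[i]'(hlt i k hk) = s i := by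
    intro i k hk
    have h1 : ((g k).toWord.take (i + 1))[i]? = ((g (N (i + 1))).toWord.take (i + 1))[i]? := by
      rw [(key (i + 1) k hk).2]
    rw [List.getElem?_take_of_lt (Nat.lt_succ_self i), List.getElem?_take_of_lt (Nat.lt_succ_self i),
      List.getElem?_eq_getElem (hlt i k hk), List.getElem?_eq_getElem (hlt i _ le_rfl)] at h1
    exact Option.some.inj h1
  have hred : ∀ i, s (i + 1) ≠ bar (s i) := by
    intro i
    have hk1 : max (N (i + 1)) (N (i + 1 + 1)) ≥ N (i + 1) := le_max_left _ _
    have hk2 : max (N (i + 1)) (N (i + 1 + 1)) ≥ N (i + 1 + 1) := le_max_right _ _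
    rw [← hs i _ hk1, ← hs (i + 1) _ hk2]
    have := isReduced_iff_isChain_bar.1
      (isReduced_toWord (x := g (max (N (i + 1)) (N (i + 1 + 1)))))
    exact List.isChain_iff_getElem.1 this i (hlt (i + 1) _ hk2)
  refine ⟨⟨s, hred⟩, convergesTo_iff.2 fun m => ?_⟩
  have hN' : ∀ᶠ k in atTop, ∀ i < m + 1, N i ≤ k := by
    filter_upwards [(Finset.eventually_all (Finset.range (m + 1))).2
      fun i _ => eventually_ge_atTop (N i)] with k hk i hi using hk i (Finset.mem_range.2 hi)
  filter_upwards [hN'] with k hk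
  rw [InfWord.le_wedge_iff, InfWord.toWord_trunc, List.prefix_iff_eq_take]
  refine List.ext_getElem ?_ ?_
  · have := (key m k (hk m (by omega))).1
    simp only [FreeGroup.norm] at this
    simp [this]
  · intro i h1 h2
    simp only [List.length_map, List.length_range] at h1
    simp [hs i k (hk (i + 1) (by omega))]

end Rays

/-! ### Bounded cancellation and boundary maps of injective homomorphisms. -/

section Embedding

variable {X Y : Type*} [DecidableEq X] [DecidableEq Y]

theorem exists_lipschitz [Finite X] (f : FreeGroup X →* FreeGroup Y) :
    ∃ M : ℕ, 1 ≤ M ∧ ∀ g, (f g).norm ≤ M * g.norm := by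
  obtain ⟨M, hM⟩ := (Set.finite_range fun x : X × Bool => (f (mk [x])).norm).bddAbove
  have hM' : ∀ x : X × Bool, (f (mk [x])).norm ≤ M + 1 :=
    fun x => (hM ⟨x, rfl⟩).trans (Nat.le_succ M)
  refine ⟨M + 1, by omega, fun g => ?_⟩
  have key : ∀ l : List (X × Bool), (f (mk l)).norm ≤ (M + 1) * l.length := by
    intro l
    induction l with
    | nil => rw [← one_eq_mk]; simp
    | cons x l ih =>
      have h1 : mk (x :: l) = mk [x] * mk l := by rw [mul_mk]; rfl
      rw [h1, _root_.map_mul, List.length_cons, mul_add, mul_one]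
      exact (FreeGroup.norm_mul_le _ _).trans (by have := hM' x; omega)
  have := key g.toWord
  rwa [mk_toWord] at this

theorem finite_norm_le [Finite X] (N : ℕ) : {g : FreeGroup X | g.norm ≤ N}.Finite :=
  Set.Finite.of_injOn (f := toWord) (fun _ hg => hg) toWord_injective.injOn
    (List.finite_length_le (X × Bool) N)

/-- Balls in a free group of finite rank are finite, and so are their preimages under an injective
map. -/
theorem exists_proper_bound [Finite Y] {f : FreeGroup X →* FreeGroup Y}
    (hf : Function.Injective f) (N : ℕ) : ∃ K, ∀ g, (f g).norm ≤ N → g.norm ≤ K := by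
  have h1 : {g : FreeGroup X | (f g).norm ≤ N}.Finite :=
    (finite_norm_le N).preimage hf.injOn
  obtain ⟨K, hK⟩ := (h1.image FreeGroup.norm).bddAbove
  exact ⟨K, fun g hg => hK ⟨g, hg, rfl⟩⟩

/-- The images of successive prefixes of l move by steps of size at most M. The step that enters the
shadow of w passes through w. -/
theorem exists_prefix_image_near {f : FreeGroup X →* FreeGroup Y} {M : ℕ}
    (hM : ∀ g, (f g).norm ≤ M * g.norm) {w : FreeGroup Y} (l : List (X × Bool))
    (h : w.toWord <+: (f (mk l)).toWord) :
    ∃ u, u <+: l ∧ ((f (mk u))⁻¹ * w).norm ≤ M := by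
  induction l using List.reverseRecOn with
  | nil =>
    refine ⟨[], List.prefix_refl _, ?_⟩
    rw [← one_eq_mk, _root_.map_one, toWord_one, List.prefix_nil, toWord_eq_nil_iff] at h
    rw [← one_eq_mk, _root_.map_one, h]; simp
  | append_singleton l x ih =>
    by_cases hw : w.toWord <+: (f (mk l)).toWord
    · obtain ⟨u, hu, hu'⟩ := ih hw
      exact ⟨u, hu.trans (List.prefix_append _ _), hu'⟩
    · refine ⟨l ++ [x], List.prefix_refl _, ?_⟩
      have h1 := norm_inv_mul_of_prefix h hw
      have h2 : (f (mk l))⁻¹ * f (mk (l ++ [x])) = f (mk [x]) := by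
        rw [← mul_mk, _root_.map_mul]; group
      have h3 := (hM (mk [x])).trans (Nat.mul_le_mul_left M norm_mk_le)
      rw [h2] at h1
      rw [norm_inv_mul_comm]
      simp at h3
      omega

/-- `f` is a quasi-isometric embedding of Cayley trees: Lipschitz, proper, and with bounded
cancellation `C`. -/
structure IsQuasiEmbedding (f : FreeGroup X →* FreeGroup Y) (M C : ℕ) : Prop where
  lipschitz : ∀ g, (f g).norm ≤ M * g.norm
  proper : ∀ N, ∃ K, ∀ g, (f g).norm ≤ N → g.norm ≤ K
  cancel : ∀ p q r, (p⁻¹ * q).norm + (q⁻¹ * r).norm = (p⁻¹ * r).norm →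
    ((f p)⁻¹ * f q).norm + ((f q)⁻¹ * f r).norm ≤ ((f p)⁻¹ * f r).norm + 2 * C

/-- Bounded cancellation. -/
theorem exists_isQuasiEmbedding [Finite X] [Finite Y] {f : FreeGroup X →* FreeGroup Y}
    (hf : Function.Injective f) : ∃ M C, IsQuasiEmbedding f M C := by
  obtain ⟨M, -, hM⟩ := exists_lipschitz f
  -- If the images of [1, g] and [1, h] share an initial segment w, each side has a point, u or v,
  -- sent within M of w. These images are at most 2M apart, so u and v are at most K apart. As 1
  -- lies between u and v, |v| ≤ K and |w| ≤ MK + M.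
  obtain ⟨K, hK⟩ := exists_proper_bound hf (2 * M)
  refine ⟨M, M * K + M, hM, exists_proper_bound hf, fun p q r h => ?_⟩
  have key : ∀ g h : FreeGroup X, g.norm + h.norm = (g⁻¹ * h).norm →
      (f g).norm + (f h).norm ≤ ((f g)⁻¹ * f h).norm + 2 * (M * K + M) := by
    intro g h hgh
    obtain ⟨w, hw1, hw2, n1, n2, n3⟩ := exists_meet (f g) (f h)
    obtain ⟨u, ⟨u', hu⟩, hu2⟩ := exists_prefix_image_near (w := w) hM g.toWord (by rwa [mk_toWord])
    obtain ⟨v, ⟨v', hv⟩, hv2⟩ := exists_prefix_image_near (w := w) hM h.toWord (by rwa [mk_toWord])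
    have hur : IsReduced u := isReduced_left (m := u') (hu ▸ isReduced_toWord)
    have hvr : IsReduced v := isReduced_left (m := v') (hv ▸ isReduced_toWord)
    have m1 := norm_of_prefix (w := mk u) (g := g) ⟨u', by rw [hur.toWord_mk, hu]⟩
    have m2 := norm_of_prefix (w := mk v) (g := h) ⟨v', by rw [hvr.toWord_mk, hv]⟩
    have t1 := norm_inv_mul_le g (mk u) h
    have t2 := norm_inv_mul_le (mk u) (mk v) h
    rw [norm_inv_mul_comm g (mk u)] at t1
    have t3 := norm_inv_mul_le (f (mk u)) w (f (mk v))
    rw [norm_inv_mul_comm w] at t3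
    have t4 := hK ((mk u)⁻¹ * mk v) (by rw [_root_.map_mul, _root_.map_inv]; omega)
    have t5 : (mk v).norm ≤ K := by omega
    have t6 := (hM (mk v)).trans (Nat.mul_le_mul_left M t5)
    have t7 := norm_le_add (f (mk v)) w
    rw [norm_inv_mul_comm w] at n1
    omega
  have := key (q⁻¹ * p) (q⁻¹ * r) (by
    rw [norm_inv_mul_comm q p, h]; congr 1; group)
  have e : (f (q⁻¹ * p))⁻¹ * f (q⁻¹ * r) = (f p)⁻¹ * f r := by
    simp only [_root_.map_mul, _root_.map_inv]; group
  rw [e] at this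
  rw [norm_inv_mul_comm]
  simpa only [_root_.map_mul, _root_.map_inv] using this

variable {f : FreeGroup X →* FreeGroup Y} {M C : ℕ}

theorem IsQuasiEmbedding.cancel_one (hf : IsQuasiEmbedding f M C) {q r : FreeGroup X}
    (h : r.norm = q.norm + (q⁻¹ * r).norm) :
    (f q).norm + ((f q)⁻¹ * f r).norm ≤ (f r).norm + 2 * C := by
  simpa using hf.cancel 1 q r (by simpa using h.symm)

theorem IsQuasiEmbedding.exists_lt_norm (hf : IsQuasiEmbedding f M C) (N : ℕ) :
    ∃ K, ∀ g, K ≤ g.norm → N < (f g).norm := by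
  obtain ⟨K, hK⟩ := hf.proper N
  refine ⟨K + 1, fun g hg => ?_⟩
  by_contra! h
  have := hK g h
  omega

theorem IsQuasiEmbedding.cancel_trunc (hf : IsQuasiEmbedding f M C) (W : InfWord X) {j k : ℕ}
    (h : j ≤ k) : (f (W.trunc j)).norm + ((f (W.trunc j))⁻¹ * f (W.trunc k)).norm ≤
      (f (W.trunc k)).norm + 2 * C :=
  hf.cancel_one (by simp [W.trunc_inv_mul h, h])

/-- The tripod spanned by 1, h and the end W has its centre at the point of W where h leaves it.
Bounded cancellation along the three sides shows that the image of this centre lies, up to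
constants, at the height where f h leaves ρ. The end W is replaced by a sufficiently remote point
`W.trunc k`. -/
theorem IsQuasiEmbedding.wedge_map (hf : IsQuasiEmbedding f M C) {W : InfWord X} {ρ : InfWord Y}
    (H : ConvergesTo (fun i => f (W.trunc i)) ρ) (h : FreeGroup X) :
    (f (W.trunc (W.wedge h))).norm ≤ ρ.wedge (f h) + 2 * C ∧
      ρ.wedge (f h) ≤ (f (W.trunc (W.wedge h))).norm + C := by
  obtain ⟨k, hk, hjk⟩ := ((convergesTo_iff.1 H (ρ.wedge (f h) + 1)).and
    (eventually_gt_atTop (W.wedge h))).exists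
  set j := W.wedge h with hj
  have h1 := InfWord.norm_inv_mul_of_wedge_lt (W := ρ) (x := f h) (g := f (W.trunc k)) (by omega)
  have h2 := InfWord.norm_inv_mul_of_wedge_lt (W := W) (x := h) (g := W.trunc k) (by simp; omega)
  have h3 := InfWord.norm_trunc_inv_mul (W := W) (g := h) (i := j) hj.le
  have h4 := W.trunc_inv_mul hjk.le
  rw [W.norm_trunc] at h2
  have h5 := hf.cancel h (W.trunc j) (W.trunc k) (by rw [norm_inv_mul_comm h]; omega)
  have h6 := hf.cancel_one (q := W.trunc j) (r := h) (by simpa using h3)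
  have h7 := hf.cancel_trunc W hjk.le
  have h8 := norm_inv_mul_le (f h) (f (W.trunc j)) (f (W.trunc k))
  have h9 := norm_le_add (f (W.trunc j)) (f (W.trunc k))
  have h10 := norm_le_add (f (W.trunc j)) (f h)
  rw [norm_inv_mul_comm (f h) (f (W.trunc j))] at h5 h8
  constructor <;> omega

/-- The boundary map is a homeomorphism onto its image. -/
theorem IsQuasiEmbedding.convergesTo_map_iff (hf : IsQuasiEmbedding f M C) {W : InfWord X}
    {ρ : InfWord Y} (H : ConvergesTo (fun i => f (W.trunc i)) ρ) {h : ℕ → FreeGroup X} :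
    ConvergesTo (fun i => f (h i)) ρ ↔ ConvergesTo h W := by
  rw [convergesTo_iff, convergesTo_iff]
  constructor
  · intro h1 m
    filter_upwards [h1 (M * m + C + 1)] with p hp
    have h2 := (hf.wedge_map H (h p)).2
    have h3 := hf.lipschitz (W.trunc (W.wedge (h p)))
    rw [InfWord.norm_trunc] at h3
    by_contra! h4
    have := Nat.mul_le_mul_left M h4.le
    omega
  · intro h1 m
    obtain ⟨K, hK⟩ := hf.exists_lt_norm (m + 2 * C)
    filter_upwards [h1 K] with p hp
    have h2 := (hf.wedge_map H (h p)).1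
    have := hK (W.trunc (W.wedge (h p))) (by simpa using hp)
    omega

theorem IsQuasiEmbedding.exists_boundary (hf : IsQuasiEmbedding f M C) (W : InfWord X) :
    ∃ ρ, ConvergesTo (fun i => f (W.trunc i)) ρ := by
  refine exists_convergesTo fun m => ?_
  obtain ⟨K, hK⟩ := hf.exists_lt_norm (m + C)
  refine ⟨K, fun j hj k hk => ?_⟩
  have := hf.cancel_trunc W hk
  have := hK (W.trunc j) (by simpa using hj)
  omega

/-- Far out, the images of `h j` and `h k` share a long initial segment of ρ. By bounded
cancellation the image of the median a of 1, `h j`, `h k` is then long, hence so is a, which is the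
convergence criterion for h. -/
theorem IsQuasiEmbedding.exists_preimage (hf : IsQuasiEmbedding f M C) {ρ : InfWord Y}
    {h : ℕ → FreeGroup X} (H : ConvergesTo (fun i => f (h i)) ρ) :
    ∃ W : InfWord X, ConvergesTo (fun i => f (W.trunc i)) ρ := by
  obtain ⟨W, hW⟩ : ∃ W : InfWord X, ConvergesTo h W := by
    refine exists_convergesTo fun m => ?_
    obtain ⟨N, hN⟩ := eventually_atTop.1 (convergesTo_iff.1 H (M * m + C + 1))
    refine ⟨N, fun j hj k hk => ?_⟩
    obtain ⟨a, -, -, n1, n2, n3⟩ := exists_meet (h j) (h k)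
    have h1 := InfWord.norm_trunc_inv_mul (hN j hj)
    have h2 := InfWord.norm_trunc_inv_mul (hN k (hj.trans hk))
    have h3 := norm_inv_mul_le (f (h j)) (ρ.trunc (M * m + C + 1)) (f (h k))
    rw [norm_inv_mul_comm (f (h j)) (ρ.trunc _)] at h3
    have h4 := hf.cancel (h j) a (h k) n3.symm
    have h5 := norm_le_add (f a) (f (h k))
    have h6 := norm_le_add' (f a) (f (h j))
    have h7 := hf.lipschitz a
    rw [norm_inv_mul_comm (h j) a] at n3
    have : m ≤ a.norm := by
      by_contra! h8
      have := Nat.mul_le_mul_left M h8.le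
      omega
    omega
  obtain ⟨ρ', hρ'⟩ := hf.exists_boundary W
  have := ((hf.convergesTo_map_iff hρ').2 hW).unique H
  exact ⟨W, this ▸ hρ'⟩

end Embedding

/-! ### Translates of rays. -/

section Translate

variable {A : Type*} [DecidableEq A]

/-- The ray `ρ'` is the translate `c ρ`. -/
def IsTranslate (c : FreeGroup A) (ρ ρ' : InfWord A) : Prop :=
  ∀ g, ρ'.wedge (c * g) ≤ ρ.wedge g + c.norm ∧ ρ.wedge g ≤ ρ'.wedge (c * g) + c.norm

/-- Left multiplication by c is an isometry moving the base point by |c|, so Gromov products change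
by at most |c|. -/
theorem exists_isTranslate (c : FreeGroup A) (ρ : InfWord A) : ∃ ρ', IsTranslate c ρ ρ' := by
  have e : ∀ g h : FreeGroup A, (c * g)⁻¹ * (c * h) = g⁻¹ * h := fun g h => by group
  have n1 : ∀ g : FreeGroup A, g.norm ≤ (c * g).norm + c.norm := fun g => by
    have := FreeGroup.norm_mul_le c⁻¹ (c * g)
    rw [norm_inv_eq, inv_mul_cancel_left] at this
    omega
  have n2 : ∀ g : FreeGroup A, (c * g).norm ≤ g.norm + c.norm := fun g => by
    have := FreeGroup.norm_mul_le c g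
    omega
  obtain ⟨ρ', h⟩ : ∃ ρ', ConvergesTo (fun i => c * ρ.trunc i) ρ' := by
    refine exists_convergesTo fun m => ⟨m + c.norm, fun j hj k hk => ?_⟩
    have h1 := n1 (ρ.trunc j)
    have h2 := n1 (ρ.trunc k)
    rw [InfWord.norm_trunc] at h1 h2
    rw [e, ρ.trunc_inv_mul hk]
    omega
  refine ⟨ρ', fun g => ?_⟩
  obtain ⟨k, hk, hk'⟩ := ((convergesTo_iff.1 h (ρ'.wedge (c * g) + 1)).and
    (eventually_gt_atTop (ρ.wedge g))).exists
  have h1 := InfWord.norm_inv_mul_of_wedge_lt (W := ρ') (x := c * g) (g := c * ρ.trunc k) (by omega)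
  have h2 := InfWord.norm_inv_mul_of_wedge_lt (W := ρ) (x := g) (g := ρ.trunc k) (by simpa)
  rw [e] at h1
  have := n1 g
  have := n2 g
  have := n1 (ρ.trunc k)
  have := n2 (ρ.trunc k)
  constructor <;> omega

variable {c : FreeGroup A} {ρ ρ' : InfWord A}

theorem IsTranslate.symm (h : IsTranslate c ρ ρ') : IsTranslate c⁻¹ ρ' ρ := by
  intro g
  have := h (c⁻¹ * g)
  rw [mul_inv_cancel_left] at this
  rw [norm_inv_eq]
  exact ⟨this.2, this.1⟩

theorem IsTranslate.convergesTo (h : IsTranslate c ρ ρ') {g : ℕ → FreeGroup A}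
    (hg : ConvergesTo g ρ) : ConvergesTo (fun i => c * g i) ρ' := by
  rw [convergesTo_iff] at *
  intro m
  filter_upwards [hg (m + c.norm)] with p hp
  have := (h (g p)).2
  omega

theorem isTranslate_of_convergesTo {g : ℕ → FreeGroup A} (hg : ConvergesTo g ρ)
    (hg' : ConvergesTo (fun i => c * g i) ρ') : IsTranslate c ρ ρ' := by
  obtain ⟨ρ'', h⟩ := exists_isTranslate c ρ
  rwa [hg'.unique (h.convergesTo hg)]

end Translate

/-! ### Attracting rays and their behaviour under quasi-isometric embeddings. -/

section Attracting

variable {A : Type*} [DecidableEq A]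

/-- Attracting rays of an endomorphism, in a form that is stable under quasi-isometries: far out
points near the ray are moved far along the ray. -/
def IsAttractingRay (f : FreeGroup A →* FreeGroup A) (ρ : InfWord A) : Prop :=
  ∀ C M : ℕ, ∃ N : ℕ, ∀ g, g.norm ≤ ρ.wedge g + C → N ≤ g.norm → g.norm + M ≤ ρ.wedge (f g)

variable {f : FreeGroup A →* FreeGroup A} {ρ : InfWord A}

/-- It is enough to test the points of the ray itself: a point within C of its projection to ρ has
its image within BC of the image of the projection, B being a Lipschitz constant of f. -/
theorem isAttractingRay_iff [Finite A] : IsAttractingRay f ρ ↔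
    ∀ M : ℕ, ∃ N : ℕ, ∀ i ≥ N, i + M ≤ ρ.wedge (f (ρ.trunc i)) := by
  constructor
  · intro h M
    obtain ⟨N, hN⟩ := h 0 M
    exact ⟨N, fun i hi => by simpa using hN (ρ.trunc i) (by simp) (by simpa)⟩
  · intro h C M
    obtain ⟨B, -, hB⟩ := exists_lipschitz f
    obtain ⟨N, hN⟩ := h (M + C + B * C)
    refine ⟨N + C, fun g hg hNg => ?_⟩
    have h1 := InfWord.norm_trunc_inv_mul (W := ρ) (g := g) le_rfl
    have h2 := hN (ρ.wedge g) (by omega)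
    have h3 := ρ.wedge_le_add (f (ρ.trunc (ρ.wedge g))) (f g)
    have h4 := (hB ((ρ.trunc (ρ.wedge g))⁻¹ * g)).trans
      (Nat.mul_le_mul_left B (show _ ≤ C by omega))
    rw [_root_.map_mul, _root_.map_inv] at h4
    omega

theorem IsAttractingRay.translate {c : FreeGroup A} {ρ' : InfWord A} (h : IsAttractingRay f ρ)
    (hc : f c = c) (ht : IsTranslate c ρ ρ') : IsAttractingRay f ρ' := by
  intro C M
  obtain ⟨N, hN⟩ := h (C + 2 * c.norm) (M + 2 * c.norm)
  refine ⟨N + c.norm, fun g hg hNg => ?_⟩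
  have h1 := (ht (c⁻¹ * g)).1
  have h2 := (ht (f (c⁻¹ * g))).2
  have h3 : c * f (c⁻¹ * g) = f g := by rw [_root_.map_mul, _root_.map_inv, hc]; group
  rw [mul_inv_cancel_left] at h1
  rw [h3] at h2
  have h4 := FreeGroup.norm_mul_le c⁻¹ g
  have h5 := norm_le_add c g
  rw [norm_inv_eq] at h4
  have h6 := hN (c⁻¹ * g) (by omega) (by omega)
  omega

theorem isAttractingFixedWord_iff {G : Type*} [Group G] {n : ℕ} (Λ : FreeGroupBasis (Fin n) G)
    (φ : G →* G) (W : InfWord (Fin n)) : IsAttractingFixedWord Λ φ W ↔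
      IsAttractingRay ((Λ.repr.toMonoidHom.comp φ).comp Λ.repr.symm.toMonoidHom) W := by
  have hφ : ∀ g, ((Λ.repr.toMonoidHom.comp φ).comp Λ.repr.symm.toMonoidHom) g =
      Λ.repr (φ (Λ.repr.symm g)) := fun _ => rfl
  rw [isAttractingRay_iff]
  simp only [hφ]
  have key : Tendsto (fun i : ℕ => (W.wedge (Λ.repr (φ (Λ.repr.symm (W.trunc i)))) : ℤ) - i)
      atTop atTop ↔
      ∀ M : ℕ, ∃ N : ℕ, ∀ i ≥ N, i + M ≤ W.wedge (Λ.repr (φ (Λ.repr.symm (W.trunc i)))) := by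
    rw [tendsto_atTop]
    constructor
    · intro h M
      obtain ⟨N, hN⟩ := eventually_atTop.1 (h M)
      exact ⟨N, fun i hi => by have := hN i hi; omega⟩
    · intro h b
      obtain ⟨N, hN⟩ := h b.toNat
      filter_upwards [eventually_ge_atTop N] with i hi
      have := hN i hi
      omega
  refine ⟨fun h => key.1 h.2, fun h => ⟨?_, key.2 h⟩⟩
  -- Attraction with margin 0 already gives |W ∧ φ(W_i)| ≥ i for large i, hence fixedness.
  refine convergesTo_iff.2 fun m => ?_
  obtain ⟨N, hN⟩ := h 0
  filter_upwards [eventually_ge_atTop (max N m)] with i hi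
  have := hN i (le_of_max_le_left hi)
  have := le_of_max_le_right hi
  omega

end Attracting

section Transfer

variable {X Y : Type*} [DecidableEq X] [DecidableEq Y]
  {f : FreeGroup X →* FreeGroup Y} {M C : ℕ} {φ : FreeGroup X →* FreeGroup X}
  {ψ : FreeGroup Y →* FreeGroup Y} {W : InfWord X} {ρ : InfWord Y}

/-- The image of `W.trunc i` is near ρ, so ψ moves it far ahead. By `wedge_map` the image of the
point where φ(W_i) leaves W is then far beyond the image of W_i. Bounded cancellation excludes that
this point precedes W_i, and the Lipschitz bound that it follows closely. -/
theorem IsQuasiEmbedding.isAttractingRay_of_map [Finite X] (hf : IsQuasiEmbedding f M C)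
    (H : ConvergesTo (fun i => f (W.trunc i)) ρ) (hφ : ∀ g, f (φ g) = ψ (f g))
    (h : IsAttractingRay ψ ρ) : IsAttractingRay φ W := by
  rw [isAttractingRay_iff]
  intro M'
  obtain ⟨N₀, hN₀⟩ := h (2 * C) (3 * C + M * M' + 1)
  obtain ⟨N, hN⟩ := hf.exists_lt_norm N₀
  refine ⟨N, fun i hi => ?_⟩
  have h1 := (hf.wedge_map H (W.trunc i)).1
  rw [InfWord.wedge_trunc] at h1
  have h2 := hN₀ _ h1 (hN _ (by simpa)).le
  rw [← hφ] at h2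
  have h3 := (hf.wedge_map H (φ (W.trunc i))).2
  by_contra! hlt
  rcases le_total (W.wedge (φ (W.trunc i))) i with hj | hj
  · have := hf.cancel_trunc W hj
    omega
  · have h4 := norm_le_add (f (W.trunc i)) (f (W.trunc (W.wedge (φ (W.trunc i)))))
    have h5 := hf.lipschitz ((W.trunc i)⁻¹ * W.trunc (W.wedge (φ (W.trunc i))))
    rw [W.trunc_inv_mul hj, _root_.map_mul, _root_.map_inv] at h5
    have := Nat.mul_le_mul_left M (show W.wedge (φ (W.trunc i)) - i ≤ M' by omega)
    omega

/-- The hypothesis `hD` lets each point of ρ be replaced by some f h. Such an h is within K of W,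
where φ is known to move points ahead; the error made by replacing is at most BD after applying ψ.
-/
theorem IsQuasiEmbedding.isAttractingRay_map [Finite Y] (hf : IsQuasiEmbedding f M C)
    (H : ConvergesTo (fun i => f (W.trunc i)) ρ) (hφ : ∀ g, f (φ g) = ψ (f g)) {D : ℕ}
    (hD : ∀ i, ∃ h, ((ρ.trunc i)⁻¹ * f h).norm ≤ D) (h : IsAttractingRay φ W) :
    IsAttractingRay ψ ρ := by
  rw [isAttractingRay_iff]
  intro M'
  obtain ⟨B, -, hB⟩ := exists_lipschitz ψ
  obtain ⟨K, hK⟩ := hf.proper (3 * C + 2 * D)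
  obtain ⟨M₁, hM₁⟩ := hf.exists_lt_norm (M' + 5 * C + D + B * D)
  obtain ⟨N₀, hN₀⟩ := h K M₁
  refine ⟨M * N₀ + C + D + 1, fun i hi => ?_⟩
  obtain ⟨h, hh⟩ := hD i
  set k := W.wedge h with hk
  have h1 := InfWord.norm_trunc_inv_mul (W := W) (g := h) (i := k) hk.le
  have h2 := ρ.wedge_le_add (ρ.trunc i) (f h)
  have h3 := (hf.wedge_map H h).2
  have h4 := norm_le_add (ρ.trunc i) (f h)
  rw [InfWord.wedge_trunc] at h2
  rw [InfWord.norm_trunc] at h4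
  rw [← hk] at h3
  have h5 := hf.cancel_one (q := W.trunc k) (r := h) (by simpa using h1)
  have h6 := hK ((W.trunc k)⁻¹ * h) (by rw [_root_.map_mul, _root_.map_inv]; omega)
  have h7 := hf.lipschitz (W.trunc k)
  rw [InfWord.norm_trunc] at h7
  have h8 : N₀ ≤ k := by
    by_contra! hlt
    have := Nat.mul_le_mul_left M hlt.le
    omega
  have h9 := hN₀ h (by omega) (by omega)
  set j := W.wedge (φ h) with hj
  have h10 := (hf.wedge_map H (φ h)).1
  rw [← hj] at h10
  have h11 := hf.cancel_trunc W (j := k) (k := j) (by omega)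
  have h12 := hM₁ ((W.trunc k)⁻¹ * W.trunc j) (by rw [W.trunc_inv_mul (by omega)]; omega)
  rw [_root_.map_mul, _root_.map_inv] at h12
  have h13 := (hB ((ρ.trunc i)⁻¹ * f h)).trans (Nat.mul_le_mul_left B hh)
  rw [_root_.map_mul, _root_.map_inv, ← hφ, norm_inv_mul_comm] at h13
  have h14 := ρ.wedge_le_add (f (φ h)) (ψ (ρ.trunc i))
  omega

end Transfer

/-! ### Tight paths in subgraphs and their images. -/

/-- All edges of the tight path `g` belong to `S`. -/
def EdgesIn {A : Type*} [DecidableEq A] (S : Set A) (g : FreeGroup A) : Prop :=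
  ∀ x ∈ g.toWord, x.1 ∈ S

section EdgesIn

variable {A : Type*} [DecidableEq A] {S : Set A} {g h : FreeGroup A}

theorem edgesIn_mk {l : List (A × Bool)} (hl : ∀ x ∈ l, x.1 ∈ S) : EdgesIn S (mk l) := by
  intro x hx
  rw [toWord_mk] at hx
  exact hl x (reduce.red.sublist.subset hx)

theorem EdgesIn.mul (hg : EdgesIn S g) (hh : EdgesIn S h) : EdgesIn S (g * h) := by
  intro x hx
  rcases List.mem_append.1 ((toWord_mul_sublist g h).subset hx) with hx | hx
  · exact hg x hx
  · exact hh x hx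

theorem EdgesIn.inv (hg : EdgesIn S g) : EdgesIn S g⁻¹ := by
  intro x hx
  rw [toWord_inv, mem_invRev] at hx
  exact hg (bar x) hx

theorem edgesIn_univ : EdgesIn Set.univ g := fun _ _ => Set.mem_univ _

theorem EdgesIn.of_prefix (hg : EdgesIn S g) (h' : h.toWord <+: g.toWord) : EdgesIn S h :=
  fun x hx => hg x (h'.subset hx)

end EdgesIn

namespace CellGraph

variable {V A : Type*} {Z : CellGraph V A} {u v w : V}

theorem isWalk_append {l m : List (A × Bool)} :
    Z.IsWalk u (l ++ m) w ↔ ∃ v, Z.IsWalk u l v ∧ Z.IsWalk v m w := by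
  constructor
  · intro h
    induction l generalizing u with
    | nil => exact ⟨u, rfl, h⟩
    | cons e l ih =>
      obtain ⟨v, h1, h2⟩ := ih h.2
      exact ⟨v, ⟨h.1, h1⟩, h2⟩
  · rintro ⟨v, h1, h2⟩
    exact h1.append h2

theorem IsWalk.unique {l : List (A × Bool)} {v' : V} (h : Z.IsWalk u l v)
    (h' : Z.IsWalk u l v') : v = v' := by
  induction l generalizing u with
  | nil => exact Eq.trans (Eq.symm h) h'
  | cons e l ih => exact ih h.2 h'.2

theorem IsWalk.red {l l' : List (A × Bool)} (h : Red l l') (hl : Z.IsWalk u l v) :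
    Z.IsWalk u l' v := by
  induction h with
  | refl => exact hl
  | tail _ h ih =>
    cases h with
    | @not l₁ l₂ x b =>
      obtain ⟨w, h1, h2, h3, h4⟩ := isWalk_append.1 ih
      refine h1.append ?_
      have : Z.term (x, !b) = Z.init (x, b) := Z.term_bar (x, b)
      rwa [this, h2] at h4

variable [DecidableEq A] {g h : FreeGroup A}

theorem isPath_mk {l : List (A × Bool)} (h : Z.IsWalk u l v) : Z.IsPath u (FreeGroup.mk l) v := by
  unfold IsPath
  rw [toWord_mk]
  exact h.red reduce.red

theorem IsPath.mul (hg : Z.IsPath u g v) (hh : Z.IsPath v h w) : Z.IsPath u (g * h) w := by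
  rw [← mk_toWord (x := g), ← mk_toWord (x := h), mul_mk]
  exact isPath_mk (IsWalk.append hg hh)

theorem IsPath.inv (hg : Z.IsPath u g v) : Z.IsPath v g⁻¹ u := by
  unfold IsPath
  rw [toWord_inv]
  exact IsWalk.invRev hg

theorem IsPath.split (hg : Z.IsPath u g v) (h' : h.toWord <+: g.toWord) :
    ∃ w, Z.IsPath u h w ∧ Z.IsPath w (h⁻¹ * g) v := by
  obtain ⟨t, ht⟩ := h'
  unfold IsPath at hg
  rw [← ht] at hg
  obtain ⟨w, h1, h2⟩ := isWalk_append.1 hg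
  refine ⟨w, h1, ?_⟩
  unfold IsPath
  rwa [toWord_inv_mul_of_prefix ht.symm]

theorem mem_pi1_iff {S : Set A} : g ∈ Z.pi1 S v ↔ Z.IsPath v g v ∧ EdgesIn S g := by
  constructor
  · rintro ⟨l, hl, hS, rfl⟩
    exact ⟨isPath_mk hl, edgesIn_mk hS⟩
  · rintro ⟨h1, h2⟩
    exact ⟨g.toWord, h1, h2, mk_toWord⟩

/-- Paths in a subgraph issuing from `v` are coarsely loops at `v`. -/
theorem exists_pi1_near [Finite V] (Z : CellGraph V A) (S : Set A) (v : V) :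
    ∃ D, ∀ g u, Z.IsPath v g u → EdgesIn S g → ∃ h : Z.pi1 S v, (g⁻¹ * h).norm ≤ D := by
  -- Each vertex that can be reached within S gets one path back to v; the others get the dummy
  -- value 1. Finiteness of V bounds the lengths of these return paths.
  have h1 : ∀ u, ∃ γ : FreeGroup A,
      (∃ g, Z.IsPath v g u ∧ EdgesIn S g) → Z.IsPath u γ v ∧ EdgesIn S γ := by
    intro u
    by_cases h : ∃ g, Z.IsPath v g u ∧ EdgesIn S g
    · obtain ⟨g, hg, hS⟩ := h
      exact ⟨g⁻¹, fun _ => ⟨hg.inv, hS.inv⟩⟩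
    · exact ⟨1, fun h' => absurd h' h⟩
  choose γ hγ using h1
  obtain ⟨D, hD⟩ := (Set.finite_range fun u => (γ u).norm).bddAbove
  refine ⟨D, fun g u hg hS => ?_⟩
  obtain ⟨h2, h3⟩ := hγ u ⟨g, hg, hS⟩
  refine ⟨⟨g * γ u, mem_pi1_iff.2 ⟨hg.mul h2, hS.mul h3⟩⟩, ?_⟩
  simpa using hD ⟨u, rfl⟩

end CellGraph


namespace GraphMap

variable {V A : Type*} [DecidableEq A] {Z : CellGraph V A} (β : GraphMap Z) {S : Set A} {u v w : V}
  {g c d : FreeGroup A}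

theorem isPath_hom (hg : Z.IsPath u g v) : Z.IsPath (β.onV u) (β.hom g) (β.onV v) := by
  obtain ⟨m, h1, -, h2⟩ := β.exists_walk β.invariant_univ hg (by simp)
  rw [mk_toWord] at h2
  exact h2 ▸ isPath_mk h1

variable {β}

theorem Invariant.edgesIn_hom (hS : β.Invariant S) (hg : EdgesIn S g) : EdgesIn S (β.hom g) := by
  have key : ∀ l : List (A × Bool), (∀ x ∈ l, x.1 ∈ S) → EdgesIn S (β.hom (FreeGroup.mk l)) := by
    intro l
    induction l with
    | nil => intro _; rw [← one_eq_mk, _root_.map_one]; simp [EdgesIn]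
    | cons x l ih =>
      intro h
      have h1 : FreeGroup.mk (x :: l) = FreeGroup.mk [x] * FreeGroup.mk l := by rw [mul_mk]; rfl
      rw [h1, _root_.map_mul]
      refine EdgesIn.mul ?_ (ih fun y hy => h y (List.mem_cons_of_mem _ hy))
      have h2 : EdgesIn S (β.onE x.1) := hS x.1 (h x List.mem_cons_self)
      obtain ⟨a, b⟩ := x
      cases b
      · simpa [hom] using h2.inv
      · simpa [hom] using h2
  have := key g.toWord hg
  rwa [mk_toWord] at this

theorem Connects.trans (hc : β.Connects c u v) (hd : β.Connects d v w) :
    β.Connects (c * d) u w :=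
  ⟨hc.1, hd.2.1, hc.2.2.1.mul hd.2.2.1, by rw [_root_.map_mul, hc.2.2.2, hd.2.2.2]⟩

theorem Connects.symm (hc : β.Connects c u v) : β.Connects c⁻¹ v u :=
  ⟨hc.2.1, hc.1, hc.2.2.1.inv, by rw [_root_.map_inv, hc.2.2.2]⟩

theorem IsFixedPointClass.mem_iff {F : Set V} (hF : β.IsFixedPointClass F) (hu : u ∈ F) :
    v ∈ F ↔ ∃ c, β.Connects c u v := by
  obtain ⟨u₀, h0, rfl⟩ := hF
  obtain ⟨c, hc⟩ := hu
  constructor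
  · rintro ⟨d, hd⟩; exact ⟨c⁻¹ * d, hc.symm.trans hd⟩
  · rintro ⟨d, hd⟩; exact ⟨c * d, hc.trans hd⟩

end GraphMap

/-! ### The boundary of a fundamental group as a space of rays. -/

section Boundary

variable {V A : Type*} {Z : CellGraph V A} {S : Set A} {v : V} {n : ℕ}

/-- The embedding of the free group on the basis `Λ` into the groupoid of tight edge paths. -/
def basisEmbedding (Λ : FreeGroupBasis (Fin n) (Z.pi1 S v)) : FreeGroup (Fin n) →* FreeGroup A :=
  (Z.pi1 S v).subtype.comp Λ.repr.symm.toMonoidHom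

variable (Λ : FreeGroupBasis (Fin n) (Z.pi1 S v))

theorem basisEmbedding_apply (g : FreeGroup (Fin n)) :
    basisEmbedding Λ g = (Λ.repr.symm g : FreeGroup A) := rfl

theorem basisEmbedding_repr (g : Z.pi1 S v) : basisEmbedding Λ (Λ.repr g) = g := by
  simp [basisEmbedding_apply]

theorem basisEmbedding_injective : Function.Injective (basisEmbedding Λ) :=
  Subtype.val_injective.comp Λ.repr.symm.injective

variable [DecidableEq A]

theorem exists_isQuasiEmbedding_basisEmbedding [Finite A] :
    ∃ M C, IsQuasiEmbedding (basisEmbedding Λ) M C :=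
  exists_isQuasiEmbedding (basisEmbedding_injective Λ)

variable {Λ} {W : InfWord (Fin n)} {ρ : InfWord A}

theorem isPath_trunc (H : ConvergesTo (fun i => basisEmbedding Λ (W.trunc i)) ρ) (i : ℕ) :
    ∃ u, Z.IsPath v (ρ.trunc i) u ∧ EdgesIn S (ρ.trunc i) := by
  obtain ⟨k, hk⟩ := (convergesTo_iff.1 H i).exists
  rw [InfWord.le_wedge_iff] at hk
  obtain ⟨h1, h2⟩ := mem_pi1_iff.1 (Λ.repr.symm (W.trunc k)).2
  obtain ⟨u, hu, -⟩ := h1.split hk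
  exact ⟨u, hu, h2.of_prefix hk⟩

theorem exists_basisEmbedding_near [Finite V] (hρ : ∀ i, ∃ u, Z.IsPath v (ρ.trunc i) u ∧
    EdgesIn S (ρ.trunc i)) :
    ∃ D, ∀ i, ∃ h, ((ρ.trunc i)⁻¹ * basisEmbedding Λ h).norm ≤ D := by
  obtain ⟨D, hD⟩ := Z.exists_pi1_near S v
  refine ⟨D, fun i => ?_⟩
  obtain ⟨u, h1, h2⟩ := hρ i
  obtain ⟨h, hh⟩ := hD _ u h1 h2
  exact ⟨Λ.repr h, by rwa [basisEmbedding_repr]⟩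

variable [Finite A]

theorem exists_boundary_ray (Λ : FreeGroupBasis (Fin n) (Z.pi1 S v)) (W : InfWord (Fin n)) :
    ∃ ρ, ConvergesTo (fun i => basisEmbedding Λ (W.trunc i)) ρ := by
  obtain ⟨M, C, hf⟩ := exists_isQuasiEmbedding_basisEmbedding Λ
  exact hf.exists_boundary W

/-- Closing up the initial segments of ρ by return paths of bounded length gives loops that converge
to ρ; then `exists_preimage` applies. -/
theorem exists_boundary_word [Finite V] (Λ : FreeGroupBasis (Fin n) (Z.pi1 S v))
    (hρ : ∀ i, ∃ u, Z.IsPath v (ρ.trunc i) u ∧ EdgesIn S (ρ.trunc i)) :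
    ∃ W : InfWord (Fin n), ConvergesTo (fun i => basisEmbedding Λ (W.trunc i)) ρ := by
  obtain ⟨M, C, hf⟩ := exists_isQuasiEmbedding_basisEmbedding Λ
  obtain ⟨D, hD⟩ := exists_basisEmbedding_near (Λ := Λ) hρ
  choose h hh using hD
  exact hf.exists_preimage ((convergesTo_trunc ρ).of_norm_le D hh)

theorem convergesTo_basisEmbedding_iff
    (H : ConvergesTo (fun i => basisEmbedding Λ (W.trunc i)) ρ) {h : ℕ → FreeGroup (Fin n)} :
    ConvergesTo (fun i => basisEmbedding Λ (h i)) ρ ↔ ConvergesTo h W := by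
  obtain ⟨M, C, hf⟩ := exists_isQuasiEmbedding_basisEmbedding Λ
  exact hf.convergesTo_map_iff H

/-- Being attracting does not depend on the choice of a basis. -/
theorem isAttractingFixedWord_iff_ray [Finite V] {β : GraphMap Z} (hS : β.Invariant S)
    (hv : β.onV v = v) (H : ConvergesTo (fun i => basisEmbedding Λ (W.trunc i)) ρ) :
    IsAttractingFixedWord Λ (β.induced hS hv) W ↔ IsAttractingRay β.hom ρ := by
  obtain ⟨M, C, hf⟩ := exists_isQuasiEmbedding_basisEmbedding Λ
  rw [isAttractingFixedWord_iff]
  have hφ : ∀ g, basisEmbedding Λ (((Λ.repr.toMonoidHom.comp (β.induced hS hv)).comp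
      Λ.repr.symm.toMonoidHom) g) = β.hom (basisEmbedding Λ g) := fun g => by
    have := basisEmbedding_repr Λ (β.induced hS hv (Λ.repr.symm g))
    exact this
  obtain ⟨D, hD⟩ := exists_basisEmbedding_near (Λ := Λ) (isPath_trunc H)
  exact ⟨hf.isAttractingRay_map H hφ hD, hf.isAttractingRay_of_map H hφ⟩

end Boundary

/-! ### The length L and legal paths. -/

section PathLength

variable {A : Type*} {L : A → ℝ}

/-- The length of a list of oriented edges. -/
def listLength (L : A → ℝ) (l : List (A × Bool)) : ℝ := (l.map fun x => L x.1).sum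

@[simp] theorem listLength_append (l m : List (A × Bool)) :
    listLength L (l ++ m) = listLength L l + listLength L m := by simp [listLength]

@[simp] theorem listLength_singleton (x : A × Bool) : listLength L [x] = L x.1 := by
  simp [listLength]

@[simp] theorem listLength_nil : listLength L [] = 0 := by simp [listLength]

theorem listLength_cons (x : A × Bool) (l : List (A × Bool)) :
    listLength L (x :: l) = L x.1 + listLength L l := by simp [listLength]

theorem listLength_invRev (l : List (A × Bool)) : listLength L (invRev l) = listLength L l := by
  induction l with
  | nil => rfl
  | cons x l ih => rw [invRev_cons_eq, listLength_append, ih, listLength_singleton, listLength_cons]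
                   exact add_comm _ _

theorem listLength_nonneg (hL : ∀ a, 0 ≤ L a) (l : List (A × Bool)) : 0 ≤ listLength L l :=
  List.sum_nonneg (by
    simp only [List.mem_map]; rintro _ ⟨x, -, rfl⟩; exact hL _)

theorem listLength_eq_zero {S : Set A} (hL : ∀ a ∈ S, L a = 0) {l : List (A × Bool)}
    (hl : ∀ x ∈ l, x.1 ∈ S) : listLength L l = 0 := by
  induction l with
  | nil => rfl
  | cons x l ih =>
    rw [listLength_cons, hL _ (hl x List.mem_cons_self),
      ih fun y hy => hl y (List.mem_cons_of_mem _ hy), add_zero]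

theorem listLength_le_mul {B : ℝ} (hB : ∀ a, L a ≤ B) (l : List (A × Bool)) :
    listLength L l ≤ B * l.length := by
  induction l with
  | nil => simp
  | cons x l ih => rw [listLength_cons, List.length_cons]; push_cast; have := hB x.1; linarith

variable [DecidableEq A]

theorem pathLength_eq (g : FreeGroup A) : pathLength L g = listLength L g.toWord := rfl

theorem pathLength_mono (hL : ∀ a, 0 ≤ L a) {g h : FreeGroup A} (H : g.toWord <+: h.toWord) :
    pathLength L g ≤ pathLength L h := by
  obtain ⟨t, ht⟩ := H
  rw [pathLength_eq, pathLength_eq, ← ht, listLength_append]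
  linarith [listLength_nonneg hL t]

theorem pathLength_mul_le (hL : ∀ a, 0 ≤ L a) (g h : FreeGroup A) :
    pathLength L (g * h) ≤ pathLength L g + pathLength L h := by
  rw [pathLength_eq, pathLength_eq, pathLength_eq, ← listLength_append]
  exact ((toWord_mul_sublist g h).map _).sum_le_sum (by
    simp only [List.mem_map]; rintro _ ⟨x, -, rfl⟩; exact hL _)

theorem pathLength_trunc_mono (hL : ∀ a, 0 ≤ L a) (ρ : InfWord A) {i j : ℕ} (h : i ≤ j) :
    pathLength L (ρ.trunc i) ≤ pathLength L (ρ.trunc j) :=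
  pathLength_mono hL (ρ.trunc_prefix_trunc h)

theorem pathLength_trunc_le {B : ℝ} (hB : ∀ a, L a ≤ B) (ρ : InfWord A) {i j : ℕ} (h : i ≤ j) :
    pathLength L (ρ.trunc j) ≤ pathLength L (ρ.trunc i) + B * (j - i : ℕ) := by
  obtain ⟨t, ht⟩ := ρ.trunc_prefix_trunc h
  have h1 := congrArg List.length ht
  rw [pathLength_eq, pathLength_eq, ← ht, listLength_append]
  simp only [List.length_append, InfWord.toWord_trunc, List.length_map, List.length_range] at h1
  have := listLength_le_mul hB t
  rw [show t.length = j - i by omega] at this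
  linarith

end PathLength

theorem exists_split_last {γ : Type*} (p : γ → Prop) (l : List γ) :
    (∀ x ∈ l, p x) ∨ ∃ a x s, l = a ++ x :: s ∧ ¬ p x ∧ ∀ y ∈ s, p y := by
  induction l with
  | nil => left; simp
  | cons y l ih =>
    rcases ih with h | ⟨a, x, s, rfl, hx, hs⟩
    · by_cases hy : p y
      · left; simpa using ⟨hy, h⟩
      · right; exact ⟨[], y, l, rfl, hy, h⟩
    · right; exact ⟨y :: a, x, s, rfl, hx, hs⟩

theorem exists_split_first {γ : Type*} (p : γ → Prop) (l : List γ) :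
    (∀ x ∈ l, p x) ∨ ∃ s y b, l = s ++ y :: b ∧ ¬ p y ∧ ∀ x ∈ s, p x := by
  induction l with
  | nil => left; simp
  | cons y l ih =>
    by_cases hy : p y
    · rcases ih with h | ⟨s, z, b, rfl, hz, hs⟩
      · left; simpa using ⟨hy, h⟩
      · right; exact ⟨y :: s, z, b, rfl, hz, by simpa using ⟨hy, hs⟩⟩
    · right; exact ⟨[], y, l, rfl, hy, by simp⟩

namespace GraphMap

variable {V A : Type*} [DecidableEq A] {Z : CellGraph V A} (β : GraphMap Z) (S₀ : Set A)

/-- Consecutive edges of a tight legal path. -/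
def LegalPair (x y : A × Bool) : Prop :=
  y ≠ bar x ∧ (x.1 ∉ S₀ → y.1 ∉ S₀ → ¬ β.IllegalTurn (bar x) y)

/-- The tightened image of an edge path. -/
def imageWord (l : List (A × Bool)) : List (A × Bool) := (β.hom (FreeGroup.mk l)).toWord

variable {β S₀}

theorem isLegal_iff {g : FreeGroup A} : β.IsLegal S₀ g ↔ g.toWord.IsChain (β.LegalPair S₀) := by
  rw [List.isChain_iff_forall_rel_of_append_cons_cons]
  constructor
  · intro h x y l m hlm
    refine ⟨?_, h l x y m hlm⟩
    have := isReduced_iff_isChain_bar.1 (isReduced_toWord (x := g))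
    rw [hlm, List.isChain_append] at this
    exact (List.isChain_cons_cons.1 this.2.1).1
  · intro h l x y m hlm
    exact (h hlm).2

theorem IllegalTurn.symm {x y : A × Bool} (h : β.IllegalTurn x y) : β.IllegalTurn y x := by
  obtain ⟨h1, k, h2⟩ := h
  exact ⟨h1.symm, k, h2.symm⟩

theorem LegalPair.mirror {x y : A × Bool} (h : β.LegalPair S₀ x y) :
    β.LegalPair S₀ (bar y) (bar x) := by
  refine ⟨fun h' => h.1 ?_, fun hy hx h' => h.2 hx hy ?_⟩
  · rw [h', bar_bar]
  · rw [bar_bar] at h'; exact h'.symm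

theorem LegalPair.isReduced {l : List (A × Bool)} (h : l.IsChain (β.LegalPair S₀)) :
    IsReduced l :=
  isReduced_iff_isChain_bar.2 (h.imp fun _ _ h => h.1)

theorem legalPair_of_mem_of_notMem {x y : A × Bool} (hx : x.1 ∈ S₀) (hy : y.1 ∉ S₀) :
    β.LegalPair S₀ x y :=
  ⟨fun h => hy (h ▸ hx), fun h => absurd hx h⟩

theorem legalPair_of_notMem_of_mem {x y : A × Bool} (hx : x.1 ∉ S₀) (hy : y.1 ∈ S₀) :
    β.LegalPair S₀ x y :=
  ⟨fun h => hx (show (bar x).1 ∈ S₀ from h ▸ hy), fun _ h => absurd hy h⟩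

theorem isChain_of_isReduced {l : List (A × Bool)} (h : IsReduced l) (hl : ∀ x ∈ l, x.1 ∈ S₀) :
    l.IsChain (β.LegalPair S₀) := by
  have h1 := isReduced_iff_isChain_bar.1 h
  clear h
  induction l with
  | nil => exact List.IsChain.nil
  | cons x l ih =>
    rw [List.isChain_cons] at h1 ⊢
    refine ⟨fun y hy => ⟨h1.1 y hy, fun hx => absurd (hl x List.mem_cons_self) hx⟩, ?_⟩
    exact ih (fun y hy => hl y (List.mem_cons_of_mem _ hy)) h1.2

theorem isReduced_imageWord (l : List (A × Bool)) : IsReduced (β.imageWord l) := isReduced_toWord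

theorem imageWord_append {l m : List (A × Bool)} (h : IsReduced (β.imageWord l ++ β.imageWord m)) :
    β.imageWord (l ++ m) = β.imageWord l ++ β.imageWord m := by
  have := toWord_mul_of_isReduced h
  rwa [← _root_.map_mul, mul_mk] at this

theorem imageWord_invRev (l : List (A × Bool)) :
    β.imageWord (invRev l) = invRev (β.imageWord l) := by
  unfold imageWord
  rw [← inv_mk, _root_.map_inv, toWord_inv]

theorem imageWord_bar (x : A × Bool) : β.imageWord [bar x] = invRev (β.imageWord [x]) :=
  imageWord_invRev [x]

theorem getLast?_imageWord (x : A × Bool) :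
    (β.imageWord [x]).getLast? = (β.D (bar x)).map bar := by
  have h : β.D (bar x) = (invRev (β.imageWord [x])).head? := by rw [← imageWord_bar]; rfl
  rw [h, head?_invRev, Option.map_map]
  have : (bar ∘ bar : A × Bool → A × Bool) = id := funext bar_bar
  rw [this]; simp

theorem imageWord_mem (hS : β.Invariant S₀) {s : List (A × Bool)} (hs : ∀ x ∈ s, x.1 ∈ S₀) :
    ∀ x ∈ β.imageWord s, x.1 ∈ S₀ :=
  hS.edgesIn_hom (edgesIn_mk hs)

theorem imageWord_singleton_cases (x : A × Bool) :
    β.imageWord [x] = (β.onE x.1).toWord ∨ β.imageWord [x] = invRev (β.onE x.1).toWord := by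
  obtain ⟨a, b⟩ := x
  cases b
  · right; simp [imageWord, hom]
  · left; simp [imageWord, hom]

/-- In contrapositive form, Dβ sends legal turns to nondegenerate legal turns: one further iterate
is all that is needed. -/
theorem IllegalTurn.of_D {x y x' y' : A × Bool} (hxy : Z.init x = Z.init y)
    (hx : β.D x = some x') (hy : β.D y = some y') (h : x' = y' ∨ β.IllegalTurn x' y') :
    β.IllegalTurn x y := by
  refine ⟨hxy, ?_⟩
  rcases h with rfl | ⟨-, k, hk⟩
  · exact ⟨1, by simp [hx, hy]⟩
  · exact ⟨k + 1, by simpa [Function.iterate_succ_apply, hx, hy] using hk⟩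

end GraphMap


open GraphMap

/-! ### Images of legal paths: no cancellation at edges outside the subgraph, expansion of L. -/

namespace Type3RTT

variable {V A : Type*} [DecidableEq A] {Z : CellGraph V A} {β : GraphMap Z} {S₀ : Set A}
  (T : Type3RTT β S₀)
include T

theorem head_imageWord {x : A × Bool} (hx : x.1 ∉ S₀) :
    ∃ e, (β.imageWord [x]).head? = some e ∧ e.1 ∉ S₀ := T.D_mem x hx

theorem last_imageWord {x y : A × Bool} (hx : x.1 ∉ S₀) (hy : y ∈ (β.imageWord [x]).getLast?) :
    β.D (bar x) = some (bar y) ∧ y.1 ∉ S₀ := by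
  obtain ⟨e, he, heS⟩ := T.D_mem (bar x) hx
  rw [getLast?_imageWord, he] at hy
  simp only [Option.map_some, Option.mem_def, Option.some.injEq] at hy
  subst hy
  exact ⟨by rw [bar_bar, he], heS⟩

theorem imageWord_ne_nil {x : A × Bool} (hx : x.1 ∉ S₀) : β.imageWord [x] ≠ [] := by
  obtain ⟨e, he, -⟩ := T.head_imageWord hx
  rintro h
  simp [h] at he

theorem isChain_imageWord_singleton {x : A × Bool} (hx : x.1 ∉ S₀) :
    (β.imageWord [x]).IsChain (β.LegalPair S₀) := by
  have h := isLegal_iff.1 (T.legal x.1 hx)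
  rcases imageWord_singleton_cases (β := β) x with h1 | h1 <;> rw [h1]
  · exact h
  · exact isChain_invRev (fun _ _ => LegalPair.mirror) h

/-- In the image of a legal path there is no cancellation behind an edge outside `S₀`. -/
theorem isChain_imageWord_cons (b : List (A × Bool)) {x : A × Bool} (hx : x.1 ∉ S₀) {u v : V}
    (hw : Z.IsWalk u (x :: b) v) (hc : (x :: b).IsChain (β.LegalPair S₀)) :
    (β.imageWord [x] ++ β.imageWord b).IsChain (β.LegalPair S₀) := by
  have hinv := T.isRTTPair.invariant
  induction hn : b.length using Nat.strong_induction_on generalizing b x u with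
  | _ n ih =>
  have hX := T.isChain_imageWord_singleton hx
  rcases exists_split_first (fun y : A × Bool => y.1 ∈ S₀) b with hb | ⟨s, y, b', rfl, hy, hs⟩
  · have h1 := imageWord_mem hinv hb
    refine List.isChain_append.2 ⟨hX, isChain_of_isReduced (isReduced_imageWord b) h1, ?_⟩
    intro p hp q hq
    exact legalPair_of_notMem_of_mem (T.last_imageWord hx hp).2 (h1 q (List.mem_of_mem_head? hq))
  · obtain ⟨w, hw1, hw2⟩ := isWalk_append.1 hw.2
    have hc' : (x :: s ++ y :: b').IsChain (β.LegalPair S₀) := hc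
    have hcy := hc'.right_of_append
    have h1 := ih b'.length (by simp at hn; omega) b' hy hw2 hcy rfl
    have h2 : β.imageWord (y :: b') = β.imageWord [y] ++ β.imageWord b' :=
      imageWord_append (l := [y]) (LegalPair.isReduced h1)
    rw [← h2] at h1
    obtain ⟨y', hy', hyS⟩ := T.head_imageWord hy
    have hhead : (β.imageWord (y :: b')).head? = some y' := by
      rw [h2, List.head?_append, hy']; rfl
    -- Here y is the next edge outside `S₀` and s the stretch inside `S₀` before it. If s is
    -- trivial, the turn between x and y is legal and stays so under Dβ. If not, the second relative
    -- train track condition makes the image of s nontrivial, and this image, which lies in `S₀`,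
    -- separates those of x and y.
    by_cases hs0 : s = []
    · subst hs0
      refine List.isChain_append.2 ⟨hX, h1, ?_⟩
      intro p hp q hq
      have hq' : q = y' := by
        have := hhead.symm.trans hq
        exact (Option.some.inj this).symm
      subst hq'
      obtain ⟨hp1, hp2⟩ := T.last_imageWord hx hp
      have hxy : β.LegalPair S₀ x y := (List.isChain_cons_cons.1 hc).1
      have hin : Z.init (bar x) = Z.init y := by
        rw [Z.init_bar]
        exact hw.2.1.symm
      have hill := hxy.2 hx hy
      refine ⟨fun h => hill ?_, fun _ _ h => hill ?_⟩
      · exact IllegalTurn.of_D hin hp1 hy' (Or.inl h.symm)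
      · exact IllegalTurn.of_D hin hp1 hy' (Or.inr h)
    · have hsred : IsReduced s := LegalPair.isReduced
        ((hc'.left_of_append).tail)
      have hsmk : (FreeGroup.mk s).toWord = s := hsred.toWord_mk
      have hne : β.imageWord s ≠ [] := by
        have := T.hom_ne_one (FreeGroup.mk s) (Z.term x) w
          (fun h => hs0 (by rw [← hsmk, h, toWord_one])) (isPath_mk hw1) (by rwa [hsmk])
          ⟨bar x, hx, Z.init_bar x⟩ ⟨y, hy, hw2.1⟩
        exact fun h => this (toWord_eq_nil_iff.1 h)
      have hsS := imageWord_mem hinv hs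
      have h3 : (β.imageWord s ++ β.imageWord (y :: b')).IsChain (β.LegalPair S₀) := by
        refine List.isChain_append.2 ⟨isChain_of_isReduced (isReduced_imageWord s) hsS, h1, ?_⟩
        intro p hp q hq
        rw [hhead] at hq
        obtain rfl := Option.some.inj hq
        exact legalPair_of_mem_of_notMem (hsS p (List.mem_of_mem_getLast? hp)) hyS
      have h4 := imageWord_append (LegalPair.isReduced h3)
      rw [h4]
      refine List.isChain_append.2 ⟨hX, h3, ?_⟩
      intro p hp q hq
      rw [List.head?_append_of_ne_nil _ hne] at hq
      exact legalPair_of_notMem_of_mem (T.last_imageWord hx hp).2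
        (hsS q (List.mem_of_mem_head? hq))

theorem isChain_imageWord_snoc (a : List (A × Bool)) {x : A × Bool} (hx : x.1 ∉ S₀) {u v : V}
    (hw : Z.IsWalk u (a ++ [x]) v) (hc : (a ++ [x]).IsChain (β.LegalPair S₀)) :
    (β.imageWord a ++ β.imageWord [x]).IsChain (β.LegalPair S₀) := by
  have h1 := hw.invRev
  have h2 := isChain_invRev (fun _ _ => LegalPair.mirror) hc
  rw [invRev_append_singleton] at h1 h2
  have h3 := isChain_invRev (fun _ _ => LegalPair.mirror)
    (T.isChain_imageWord_cons (invRev a) (x := bar x) hx h1 h2)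
  rwa [imageWord_invRev, imageWord_bar, ← invRev_append, invRev_invRev] at h3

theorem isChain_imageWord_append (a b : List (A × Bool)) {x : A × Bool} (hx : x.1 ∉ S₀) {u v : V}
    (hw : Z.IsWalk u (a ++ x :: b) v) (hc : (a ++ x :: b).IsChain (β.LegalPair S₀)) :
    (β.imageWord a ++ (β.imageWord [x] ++ β.imageWord b)).IsChain (β.LegalPair S₀) := by
  have e : a ++ x :: b = (a ++ [x]) ++ b := by simp
  obtain ⟨w, hw1, hw2⟩ := isWalk_append.1 hw
  have h1 := T.isChain_imageWord_cons b hx hw2 hc.right_of_append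
  rw [e] at hw hc
  obtain ⟨w', hw3, -⟩ := isWalk_append.1 hw
  have h2 := T.isChain_imageWord_snoc a hx hw3 hc.left_of_append
  refine List.isChain_append.2 ⟨h2.left_of_append, h1, fun p hp q hq => ?_⟩
  rw [List.head?_append_of_ne_nil _ (T.imageWord_ne_nil hx)] at hq
  exact (List.isChain_append.1 h2).2.2 p hp q hq

theorem imageWord_append_cons (a b : List (A × Bool)) {x : A × Bool} (hx : x.1 ∉ S₀) {u v : V}
    (hw : Z.IsWalk u (a ++ x :: b) v) (hc : (a ++ x :: b).IsChain (β.LegalPair S₀)) :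
    β.imageWord (a ++ x :: b) = β.imageWord a ++ (β.imageWord [x] ++ β.imageWord b) := by
  have h1 := LegalPair.isReduced (T.isChain_imageWord_append a b hx hw hc)
  have h2 : β.imageWord (x :: b) = β.imageWord [x] ++ β.imageWord b :=
    imageWord_append (l := [x]) (isReduced_right h1)
  rw [← h2] at h1 ⊢
  exact imageWord_append h1

theorem imageWord_append_singleton (a : List (A × Bool)) {x : A × Bool} (hx : x.1 ∉ S₀) {u v : V}
    (hw : Z.IsWalk u (a ++ [x]) v) (hc : (a ++ [x]).IsChain (β.LegalPair S₀)) :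
    β.imageWord (a ++ [x]) = β.imageWord a ++ β.imageWord [x] :=
  imageWord_append (LegalPair.isReduced (T.isChain_imageWord_snoc a hx hw hc))

theorem L_nonneg (a : A) : 0 ≤ T.L a := by
  by_cases h : a ∈ S₀
  · exact (T.L_eq_zero a h).ge
  · exact (T.L_pos a h).le

theorem listLength_imageWord_singleton {x : A × Bool} (hx : x.1 ∉ S₀) :
    listLength T.L (β.imageWord [x]) = T.factor * T.L x.1 := by
  have h := T.expands x.1 hx
  rw [pathLength_eq] at h
  rcases imageWord_singleton_cases (β := β) x with h1 | h1 <;> rw [h1]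
  · exact h
  · rw [listLength_invRev, h]

theorem listLength_imageWord (l : List (A × Bool)) {u v : V} (hw : Z.IsWalk u l v)
    (hc : l.IsChain (β.LegalPair S₀)) :
    listLength T.L (β.imageWord l) = T.factor * listLength T.L l := by
  induction hn : l.length using Nat.strong_induction_on generalizing l u v with
  | _ n ih =>
  rcases exists_split_first (fun y : A × Bool => y.1 ∈ S₀) l with hl | ⟨s, y, b, rfl, hy, hs⟩
  · rw [listLength_eq_zero T.L_eq_zero hl,
      listLength_eq_zero T.L_eq_zero (imageWord_mem T.isRTTPair.invariant hl), mul_zero]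
  · rw [T.imageWord_append_cons s b hy hw hc]
    obtain ⟨w, -, hw2⟩ := isWalk_append.1 hw
    have h1 := ih b.length (by simp at hn; omega) b hw2.2 hc.right_of_append.tail rfl
    simp only [listLength_append, listLength_cons]
    rw [h1, T.listLength_imageWord_singleton hy, listLength_eq_zero T.L_eq_zero hs,
      listLength_eq_zero T.L_eq_zero (imageWord_mem T.isRTTPair.invariant hs)]
    ring

variable {g a : FreeGroup A} {u v : V}

theorem isLegal_hom (hp : Z.IsPath u g v) (hg : β.IsLegal S₀ g) : β.IsLegal S₀ (β.hom g) := by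
  rw [isLegal_iff] at hg
  have e : (β.hom g).toWord = β.imageWord g.toWord := by rw [imageWord, mk_toWord]
  rw [isLegal_iff, e]
  rcases exists_split_first (fun y : A × Bool => y.1 ∈ S₀) g.toWord with hl | ⟨s, y, b, h, hy, hs⟩
  · exact isChain_of_isReduced (isReduced_imageWord _) (imageWord_mem T.isRTTPair.invariant hl)
  · unfold IsPath at hp
    rw [h] at hp hg ⊢
    rw [T.imageWord_append_cons s b hy hp hg]
    exact T.isChain_imageWord_append s b hy hp hg

theorem pathLength_hom (hp : Z.IsPath u g v) (hg : β.IsLegal S₀ g) :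
    pathLength T.L (β.hom g) = T.factor * pathLength T.L g := by
  have := T.listLength_imageWord g.toWord hp (isLegal_iff.1 hg)
  rwa [imageWord, mk_toWord] at this

end Type3RTT

/-- The last edge of the tight path `g` exists and lies outside `S₀`. -/
def EndsOutside {A : Type*} [DecidableEq A] (S₀ : Set A) (g : FreeGroup A) : Prop :=
  ∃ l x, g.toWord = l ++ [x] ∧ x.1 ∉ S₀

namespace Type3RTT

variable {V A : Type*} [DecidableEq A] {Z : CellGraph V A} {β : GraphMap Z} {S₀ : Set A}
  (T : Type3RTT β S₀) {g a : FreeGroup A} {u v : V}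
include T

/-- The last edge of a is outside `S₀` and protects the image of a from cancelling against what
follows; an a ending in `S₀` would lack this protection. The image of a again ends outside `S₀`, so
the statement can be iterated. -/
theorem prefix_hom (hp : Z.IsPath u g v) (hg : β.IsLegal S₀ g) (ha : a.toWord <+: g.toWord)
    (hE : EndsOutside S₀ a) :
    (β.hom a).toWord <+: (β.hom g).toWord ∧ EndsOutside S₀ (β.hom a) := by
  rw [isLegal_iff] at hg
  obtain ⟨b, hb⟩ := ha
  obtain ⟨l, x, hl, hx⟩ := hE
  have e1 : (β.hom g).toWord = β.imageWord g.toWord := by rw [imageWord, mk_toWord]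
  have e2 : (β.hom a).toWord = β.imageWord a.toWord := by rw [imageWord, mk_toWord]
  have e3 : g.toWord = l ++ x :: b := by rw [← hb, hl]; simp
  unfold IsPath at hp
  have hg' := hg
  have hp' := hp
  rw [← hb] at hg' hp'
  obtain ⟨w, hp', -⟩ := isWalk_append.1 hp'
  have hg' := hg'.left_of_append
  rw [e3] at hg hp
  rw [hl] at hg' hp'
  have e4 : (β.hom a).toWord = β.imageWord l ++ β.imageWord [x] := by
    rw [e2, hl, T.imageWord_append_singleton l hx hp' hg']
  constructor
  · rw [e4, e1, e3, T.imageWord_append_cons l b hx hp hg, ← List.append_assoc]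
    exact List.prefix_append _ _
  · obtain ⟨m, y, hm⟩ := List.eq_nil_or_concat'  (β.imageWord [x]) |>.resolve_left
      (T.imageWord_ne_nil hx)
    refine ⟨β.imageWord l ++ m, y, by rw [e4, hm, List.append_assoc], ?_⟩
    exact (T.last_imageWord hx (by simp [hm])).2

end Type3RTT

theorem head?_of_prefix {γ : Type*} {l m : List γ} (h : l <+: m) (hl : l ≠ []) :
    l.head? = m.head? := by
  obtain ⟨t, rfl⟩ := h
  rw [List.head?_append_of_ne_nil _ hl]

/-! ### Initial segments and tails of rays. -/

section RayPrefix

variable {A : Type*} [DecidableEq A] {ρ : InfWord A} {a g : FreeGroup A}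

theorem InfWord.wedge_mono (h : a.toWord <+: g.toWord) : ρ.wedge a ≤ ρ.wedge g :=
  InfWord.le_wedge_iff.2 ((InfWord.le_wedge_iff.1 le_rfl).trans h)

theorem InfWord.eq_trunc (h : g.norm ≤ ρ.wedge g) : g = ρ.trunc g.norm := by
  refine (toWord_injective ((InfWord.le_wedge_iff.1 h).eq_of_length ?_)).symm
  simp [InfWord.toWord_trunc, FreeGroup.norm]

theorem InfWord.norm_le_wedge_of_prefix (h : a.toWord <+: g.toWord) (hg : a.norm ≤ ρ.wedge g) :
    a.norm ≤ ρ.wedge a := by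
  have h1 := InfWord.le_wedge_iff.1 hg
  have h2 := List.prefix_of_prefix_length_le h1 h (by simp [InfWord.toWord_trunc, FreeGroup.norm])
  exact InfWord.le_wedge_iff.2 h2

theorem InfWord.head?_of_norm_le_wedge (h : g.norm ≤ ρ.wedge g) (hg : g ≠ 1) :
    g.toWord.head? = some (ρ.seq 0) := by
  rw [InfWord.eq_trunc h, InfWord.toWord_trunc]
  have : g.norm ≠ 0 := fun h => hg (norm_eq_zero.1 h)
  obtain ⟨n, hn⟩ := Nat.exists_eq_succ_of_ne_zero this
  rw [hn, Nat.succ_eq_add_one, List.range_succ_eq_map]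
  rfl

/-- The tail of a ray. -/
def InfWord.drop (ρ : InfWord A) (i : ℕ) : InfWord A :=
  ⟨fun k => ρ.seq (i + k), fun k => ρ.reduced (i + k)⟩

theorem InfWord.toWord_trunc_add (ρ : InfWord A) (i m : ℕ) :
    (ρ.trunc (i + m)).toWord = (ρ.trunc i).toWord ++ ((ρ.drop i).trunc m).toWord := by
  rw [InfWord.toWord_trunc, InfWord.toWord_trunc, InfWord.toWord_trunc, List.range_add,
    List.map_append, List.map_map]
  rfl

theorem InfWord.trunc_add (ρ : InfWord A) (i m : ℕ) :
    ρ.trunc (i + m) = ρ.trunc i * (ρ.drop i).trunc m :=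
  eq_mul_of_toWord (ρ.toWord_trunc_add i m)

theorem InfWord.le_wedge_drop {i m : ℕ} (h : i + m ≤ ρ.wedge g) :
    m ≤ (ρ.drop i).wedge ((ρ.trunc i)⁻¹ * g) := by
  obtain ⟨t, ht⟩ := InfWord.le_wedge_iff.1 h
  rw [InfWord.toWord_trunc_add, List.append_assoc] at ht
  rw [InfWord.le_wedge_iff, toWord_inv_mul_of_prefix ht.symm]
  exact List.prefix_append _ _

theorem InfWord.isTranslate_drop (ρ : InfWord A) (i : ℕ) :
    IsTranslate (ρ.trunc i) (ρ.drop i) ρ := by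
  refine isTranslate_of_convergesTo (convergesTo_trunc _) ?_
  simp_rw [← InfWord.trunc_add]
  have h : Tendsto (fun k => i + k) atTop atTop := tendsto_add_atTop_nat i |>.congr (by simp [add_comm])
  exact (convergesTo_trunc ρ).comp h

/-- If two rays are translates of each other, then the translating path runs along one of the rays
and then back along the other. -/
theorem IsTranslate.exists_halves {p : FreeGroup A} {ρ₁ ρ₂ : InfWord A} (h : IsTranslate p ρ₂ ρ₁) :
    ∃ q₁ q₂ : FreeGroup A, p.toWord = q₁.toWord ++ q₂⁻¹.toWord ∧
      q₁.norm ≤ ρ₁.wedge q₁ ∧ q₂.norm ≤ ρ₂.wedge q₂ := by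
  -- The path p⁻¹ follows ρ₂ as far as it can, which gives q₂, and then leaves it along r; q₁ is the
  -- reverse of r. Nothing of q₁ cancels in p times a remote point of ρ₂, so q₁ is an initial
  -- segment of ρ₁.
  obtain ⟨r, hr⟩ := InfWord.le_wedge_iff.1 (le_refl (ρ₂.wedge p⁻¹))
  have hred : IsReduced r := isReduced_right (hr ▸ isReduced_toWord)
  have hq : (FreeGroup.mk (invRev r)).toWord = invRev r := hred.invRev'.toWord_mk
  refine ⟨FreeGroup.mk (invRev r), ρ₂.trunc (ρ₂.wedge p⁻¹), ?_, ?_, by simp⟩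
  · rw [hq, toWord_inv, ← invRev_append, hr, toWord_inv, invRev_invRev]
  · obtain ⟨k, hk, hk'⟩ := ((convergesTo_iff.1 (h.convergesTo (convergesTo_trunc ρ₂))
      (FreeGroup.mk (invRev r)).norm).and (eventually_gt_atTop (ρ₂.wedge p⁻¹))).exists
    refine InfWord.norm_le_wedge_of_prefix (g := p * ρ₂.trunc k) ?_ hk
    obtain ⟨m, rfl⟩ := Nat.exists_eq_add_of_lt hk'
    have h1 : (p⁻¹⁻¹ * ρ₂.trunc (ρ₂.wedge p⁻¹ + (m + 1))).toWord = invRev r ++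
        ((ρ₂.drop (ρ₂.wedge p⁻¹)).trunc (m + 1)).toWord := by
      refine toWord_inv_mul hr.symm (ρ₂.toWord_trunc_add _ _) ?_
      rintro x hx y hy rfl
      have hlt : ρ₂.wedge p⁻¹ + 1 ≤ ρ₂.wedge p⁻¹ := by
        rw [InfWord.le_wedge_iff, InfWord.toWord_trunc_add, ← hr]
        cases r with
        | nil => simp at hx
        | cons z r =>
          simp only [List.head?_cons, Option.mem_def, Option.some.injEq] at hx
          subst hx
          rw [InfWord.toWord_trunc, List.range_succ_eq_map] at hy
          simp only [List.map_cons, List.head?_cons, Option.mem_def, Option.some.injEq] at hy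
          refine (List.prefix_append_right_inj _).2 ⟨r, ?_⟩
          rw [InfWord.toWord_trunc, ← hy]; rfl
      omega
    rw [inv_inv] at h1
    rw [hq, add_assoc, h1]
    exact List.prefix_append _ _

end RayPrefix

/-! ### The rays β^∞(e). -/

namespace Type3RTT

variable {V A : Type*} [DecidableEq A] {Z : CellGraph V A} {β : GraphMap Z} {S₀ : Set A}
  (T : Type3RTT β S₀) {g a : FreeGroup A} {u v : V}

theorem isPath_edge (Z : CellGraph V A) (e : A × Bool) :
    Z.IsPath (Z.init e) (FreeGroup.mk [e]) (Z.term e) := isPath_mk ⟨rfl, rfl⟩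

theorem isLegal_of_prefix (hg : β.IsLegal S₀ g) (h : a.toWord <+: g.toWord) : β.IsLegal S₀ a := by
  rw [isLegal_iff] at *
  exact List.IsChain.prefix hg h

theorem toWord_edge (e : A × Bool) : (FreeGroup.mk [e]).toWord = [e] := rfl

theorem isLegal_edge (e : A × Bool) : β.IsLegal S₀ (FreeGroup.mk [e]) := by
  rw [isLegal_iff, toWord_edge]
  exact List.isChain_singleton _

include T

theorem iterate_hom (hp : Z.IsPath u g v) (hg : β.IsLegal S₀ g) (ha : a.toWord <+: g.toWord)
    (hE : EndsOutside S₀ a) (k : ℕ) :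
    (∃ u' v', Z.IsPath u' (β.hom^[k] g) v') ∧ β.IsLegal S₀ (β.hom^[k] g) ∧
      (β.hom^[k] a).toWord <+: (β.hom^[k] g).toWord ∧ EndsOutside S₀ (β.hom^[k] a) ∧
      pathLength T.L (β.hom^[k] a) = T.factor ^ k * pathLength T.L a := by
  induction k with
  | zero => exact ⟨⟨u, v, hp⟩, hg, ha, hE, by simp⟩
  | succ k ih =>
    obtain ⟨⟨u', v', h1⟩, h2, h3, h4, h5⟩ := ih
    obtain ⟨h6, h7⟩ := T.prefix_hom h1 h2 h3 h4
    obtain ⟨w, hw, -⟩ := h1.split h3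
    simp only [Function.iterate_succ_apply']
    refine ⟨⟨_, _, β.isPath_hom h1⟩, T.isLegal_hom h1 h2, h6, h7, ?_⟩
    rw [T.pathLength_hom hw (isLegal_of_prefix h2 h3), h5]
    ring

variable {e : A × Bool}

theorem iterate_edge (he : e.1 ∉ S₀) (k : ℕ) :
    (∃ u' v', Z.IsPath u' (β.hom^[k] (FreeGroup.mk [e])) v') ∧
      β.IsLegal S₀ (β.hom^[k] (FreeGroup.mk [e])) ∧
      EndsOutside S₀ (β.hom^[k] (FreeGroup.mk [e])) ∧
      pathLength T.L (β.hom^[k] (FreeGroup.mk [e])) = T.factor ^ k * T.L e.1 := by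
  obtain ⟨h1, h2, -, h3, h4⟩ := T.iterate_hom (isPath_edge Z e) (isLegal_edge e)
    (List.prefix_refl _) ⟨[], e, rfl, he⟩ k
  refine ⟨h1, h2, h3, ?_⟩
  rw [h4, pathLength_eq, toWord_edge, listLength_singleton]

/-- The equation Dβ(e) = e says that e is an initial segment of the legal path β(e), and iterates of
β preserve this relation. -/
theorem iterate_edge_prefix_succ (he : e.1 ∉ S₀) (hD : β.D e = some e) (k : ℕ) :
    (β.hom^[k] (FreeGroup.mk [e])).toWord <+: (β.hom^[k + 1] (FreeGroup.mk [e])).toWord := by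
  rw [Function.iterate_succ_apply]
  refine (T.iterate_hom (β.isPath_hom (isPath_edge Z e))
    (T.isLegal_hom (isPath_edge Z e) (isLegal_edge e)) ?_ ⟨[], e, rfl, he⟩ k).2.2.1
  rw [toWord_edge]
  unfold GraphMap.D at hD
  obtain ⟨l, hl⟩ := List.head?_eq_some_iff.1 hD
  exact ⟨l, hl.symm⟩

theorem iterate_edge_prefix (he : e.1 ∉ S₀) (hD : β.D e = some e) {j k : ℕ} (h : j ≤ k) :
    (β.hom^[j] (FreeGroup.mk [e])).toWord <+: (β.hom^[k] (FreeGroup.mk [e])).toWord := by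
  induction k, h using Nat.le_induction with
  | base => exact List.prefix_refl _
  | succ k _ ih => exact ih.trans (T.iterate_edge_prefix_succ he hD k)

theorem tendsto_pathLength_iterate (he : e.1 ∉ S₀) :
    Tendsto (fun k => pathLength T.L (β.hom^[k] (FreeGroup.mk [e]))) atTop atTop := by
  simp_rw [fun k => (T.iterate_edge he k).2.2.2]
  exact (tendsto_pow_atTop_atTop_of_one_lt T.one_lt_factor).atTop_mul_const (T.L_pos _ he)

theorem exists_length_bound [Finite A] : ∃ B : ℝ, 0 < B ∧ ∀ a, T.L a ≤ B := by
  obtain ⟨B, hB⟩ := (Set.finite_range T.L).bddAbove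
  exact ⟨max B 1, by positivity, fun a => (hB ⟨a, rfl⟩).trans (le_max_left _ _)⟩

theorem exists_edgeRay [Finite A] (he : e.1 ∉ S₀) (hD : β.D e = some e) :
    ∃ ρ, ConvergesTo (fun k => β.hom^[k] (FreeGroup.mk [e])) ρ := by
  obtain ⟨B, hB0, hB⟩ := T.exists_length_bound
  refine exists_convergesTo fun m => ?_
  obtain ⟨N, hN⟩ := ((tendsto_atTop.1 (T.tendsto_pathLength_iterate he)) (B * m)).exists
  refine ⟨N, fun j hj k hk => ?_⟩
  have h1 := norm_of_prefix (T.iterate_edge_prefix he hD hk)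
  have h2 := norm_of_prefix (T.iterate_edge_prefix he hD hj)
  have h3 := listLength_le_mul hB (β.hom^[N] (FreeGroup.mk [e])).toWord
  have h4 : (m : ℝ) ≤ (β.hom^[N] (FreeGroup.mk [e])).norm :=
    le_of_mul_le_mul_left (hN.trans h3) hB0
  have h5 : m ≤ (β.hom^[N] (FreeGroup.mk [e])).norm := by exact_mod_cast h4
  omega

/-- The iterated images of a legal path beginning with `e` converge to `β^∞(e)`. -/
theorem convergesTo_iterate (he : e.1 ∉ S₀) {ρ : InfWord A}
    (hρ : ConvergesTo (fun k => β.hom^[k] (FreeGroup.mk [e])) ρ) (hp : Z.IsPath u g v) (hg : β.IsLegal S₀ g)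
    (h : g.toWord.head? = some e) : ConvergesTo (fun k => β.hom^[k] g) ρ := by
  obtain ⟨l, hl⟩ := List.head?_eq_some_iff.1 h
  rw [convergesTo_iff] at *
  intro m
  filter_upwards [hρ m] with k hk
  refine hk.trans (InfWord.wedge_mono ?_)
  exact (T.iterate_hom hp hg ⟨l, by rw [hl]; rfl⟩ ⟨[], e, rfl, he⟩ k).2.2.1

end Type3RTT

section EdgeRay

variable {V A : Type*} [DecidableEq A] {Z : CellGraph V A} {β : GraphMap Z} {S₀ : Set A}
  (T : Type3RTT β S₀) {g a : FreeGroup A} {u v : V} {e : A × Bool} {ρ : InfWord A}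
  (he : e.1 ∉ S₀) (hD : β.D e = some e)
  (hρ : ConvergesTo (fun k => β.hom^[k] (FreeGroup.mk [e])) ρ)

include T he hD hρ

namespace Type3RTT

theorem norm_le_wedge_iterate (k : ℕ) :
    (β.hom^[k] (FreeGroup.mk [e])).norm ≤ ρ.wedge (β.hom^[k] (FreeGroup.mk [e])) := by
  obtain ⟨m, hm, hkm⟩ := ((convergesTo_iff.1 hρ (β.hom^[k] (FreeGroup.mk [e])).norm).and
    (eventually_ge_atTop k)).exists
  exact InfWord.norm_le_wedge_of_prefix (T.iterate_edge_prefix he hD hkm) hm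

theorem edgeRay_zero : ρ.seq 0 = e := by
  have h := T.norm_le_wedge_iterate he hD hρ 0
  have := InfWord.head?_of_norm_le_wedge h (fun h => by
    have := congrArg toWord h
    simp at this)
  exact (Option.some.inj this).symm

/-- Initial segments of the ray are legal and β preserves the ray, so the image of a segment follows
the ray up to cancellation inside `S₀`, which costs no L-length. -/
theorem pathLength_edgeRay_le (m : ℕ) : T.factor * pathLength T.L (ρ.trunc m) ≤
    pathLength T.L (ρ.trunc (ρ.wedge (β.hom (ρ.trunc m)))) := by
  -- Cut the segment behind its last edge outside `S₀`. The remaining part σ has the same L-length,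
  -- and its image survives entirely as an initial segment of the ray.
  rcases exists_split_last (fun y : A × Bool => y.1 ∈ S₀) (ρ.trunc m).toWord with
    h | ⟨b, x, s, h, hx, hs⟩
  · rw [pathLength_eq, listLength_eq_zero T.L_eq_zero h, mul_zero]
    exact listLength_nonneg T.L_nonneg _
  · obtain ⟨k, hk⟩ := (convergesTo_iff.1 hρ m).exists
    rw [InfWord.le_wedge_iff] at hk
    obtain ⟨⟨u', v', h1⟩, h2, -⟩ := T.iterate_edge (β := β) he k
    obtain ⟨w, hw, -⟩ := h1.split hk
    have h3 := isLegal_of_prefix h2 hk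
    have h' : (ρ.trunc m).toWord = (b ++ [x]) ++ s := by simp [h]
    have hσ : (FreeGroup.mk (b ++ [x])).toWord = b ++ [x] :=
      (isReduced_left (h' ▸ isReduced_toWord)).toWord_mk
    set σ := FreeGroup.mk (b ++ [x]) with hσdef
    have h4 : σ.toWord <+: (ρ.trunc m).toWord := ⟨s, by rw [hσ, h']⟩
    have hE : EndsOutside S₀ σ := ⟨b, x, hσ, hx⟩
    have h5 := (T.prefix_hom hw h3 h4 hE).1
    have h6 := (T.prefix_hom h1 h2 (h4.trans hk) hE).1
    rw [← Function.iterate_succ_apply' (β.hom)] at h6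
    have h7 := T.norm_le_wedge_iterate he hD hρ (k + 1)
    have h8 : (β.hom σ).norm ≤ ρ.wedge (β.hom σ) :=
      InfWord.norm_le_wedge_of_prefix h6 (h6.length_le.trans h7)
    obtain ⟨w', hw', -⟩ := hw.split h4
    have h9 := T.pathLength_hom hw' (isLegal_of_prefix h3 h4)
    have h10 : pathLength T.L (ρ.trunc m) = pathLength T.L σ := by
      rw [pathLength_eq, pathLength_eq, h', hσ, listLength_append (b ++ [x]),
        listLength_eq_zero T.L_eq_zero hs, add_zero]
    rw [h10, ← h9, InfWord.eq_trunc h8]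
    exact pathLength_trunc_mono T.L_nonneg ρ (h8.trans (InfWord.wedge_mono h5))

theorem pathLength_edgeRay_pos {m : ℕ} (hm : 1 ≤ m) : 0 < pathLength T.L (ρ.trunc m) := by
  refine lt_of_lt_of_le ?_ (pathLength_trunc_mono T.L_nonneg ρ hm)
  rw [pathLength_eq, InfWord.toWord_trunc]
  simpa [T.edgeRay_zero he hD hρ] using T.L_pos _ he

/-- Points of `β^∞(e)` are moved away from the origin. -/
theorem lt_wedge_edgeRay {m : ℕ} (hm : 1 ≤ m) : m < ρ.wedge (β.hom (ρ.trunc m)) := by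
  by_contra! h
  have h1 := T.pathLength_edgeRay_le he hD hρ m
  have h2 := pathLength_trunc_mono T.L_nonneg ρ h
  have h3 := T.pathLength_edgeRay_pos he hD hρ hm
  nlinarith [T.one_lt_factor]

theorem hom_ne_of_prefix_edgeRay (hg : g.norm ≤ ρ.wedge g) (h1 : g ≠ 1) : β.hom g ≠ g := by
  intro h
  have h2 : 1 ≤ g.norm := Nat.one_le_iff_ne_zero.2 fun h => h1 (norm_eq_zero.1 h)
  have h3 := T.lt_wedge_edgeRay he hD hρ h2
  rw [← InfWord.eq_trunc hg, h] at h3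
  exact absurd (ρ.wedge_le_norm g) (by omega)

theorem exists_lt_pathLength_trunc (K : ℝ) : ∃ m, K < pathLength T.L (ρ.trunc m) := by
  obtain ⟨k, hk⟩ := ((T.tendsto_pathLength_iterate (β := β) he).eventually_gt_atTop K).exists
  rw [InfWord.eq_trunc (T.norm_le_wedge_iterate he hD hρ k)] at hk
  exact ⟨_, hk⟩

/-- The gain in L-length is at least (λ − 1) times the L-length already covered, which is unbounded
along the ray. As no edge is longer than B, this forces an unbounded gain in the number of edges. -/
theorem isAttractingRay_edgeRay [Finite A] : IsAttractingRay β.hom ρ := by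
  rw [isAttractingRay_iff]
  intro M
  obtain ⟨B, hB0, hB⟩ := T.exists_length_bound
  have hpos : 0 < T.factor - 1 := by linarith [T.one_lt_factor]
  obtain ⟨N, hN⟩ := T.exists_lt_pathLength_trunc he hD hρ (B * M / (T.factor - 1))
  refine ⟨N + 1, fun m hm => ?_⟩
  have h1 := pathLength_trunc_mono T.L_nonneg ρ (show N ≤ m by omega)
  have h2 := T.lt_wedge_edgeRay he hD hρ (show 1 ≤ m by omega)
  have h3 := T.pathLength_edgeRay_le he hD hρ m
  have h4 := pathLength_trunc_le hB ρ h2.le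
  rw [div_lt_iff₀ hpos] at hN
  have h5 : B * M < B * (ρ.wedge (β.hom (ρ.trunc m)) - m : ℕ) := by nlinarith
  have h6 : M < ρ.wedge (β.hom (ρ.trunc m)) - m := by exact_mod_cast lt_of_mul_lt_mul_left h5 hB0.le
  omega

end Type3RTT

end EdgeRay

/-! ### The classes attached to edges, and Nielsen paths. -/

section EdgeClass

variable {V A : Type*} [DecidableEq A] {Z : CellGraph V A} {β : GraphMap Z}
  {S₀ : Set A} (T : Type3RTT β S₀) {v₀ : V} {n : ℕ} {Λ : FreeGroupBasis (Fin n) (Z.pi1 Set.univ v₀)}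
  {W : InfWord (Fin n)}

theorem fixEquiv_refl {G : Type*} [Group G] (Λ : FreeGroupBasis (Fin n) G) (φ : G →* G)
    (W : InfWord (Fin n)) : FixEquiv Λ φ W W :=
  ⟨1, _root_.map_one φ, by simpa using convergesTo_trunc W⟩

theorem edgeClass_nonempty [Finite V] [Finite A] (Λ : FreeGroupBasis (Fin n) (Z.pi1 Set.univ v₀)) {e : A × Bool}
    {c : FreeGroup A} (hc : β.Connects c v₀ (Z.init e)) {ρ : InfWord A}
    (hρ : ConvergesTo (fun k => β.hom^[k] (FreeGroup.mk [e])) ρ) :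
    ∃ W, W ∈ edgeClass β Λ e := by
  obtain ⟨ρ', hρ'⟩ := exists_isTranslate c ρ
  have hconv := hρ'.convergesTo hρ
  have hiter : ∀ k, ∃ u, Z.IsPath v₀ (c * β.hom^[k] (FreeGroup.mk [e])) u := by
    intro k
    have h : ∃ u, Z.IsPath (Z.init e) (β.hom^[k] (FreeGroup.mk [e])) u := by
      induction k with
      | zero => exact ⟨_, Type3RTT.isPath_edge Z e⟩
      | succ k ih =>
        obtain ⟨u, hu⟩ := ih
        rw [Function.iterate_succ_apply']
        have := β.isPath_hom hu
        rw [hc.2.1] at this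
        exact ⟨_, this⟩
    obtain ⟨u, hu⟩ := h
    exact ⟨u, hc.2.2.1.mul hu⟩
  obtain ⟨W, hW⟩ := exists_boundary_word Λ (ρ := ρ') fun i => by
    obtain ⟨k, hk⟩ := (convergesTo_iff.1 hconv i).exists
    rw [InfWord.le_wedge_iff] at hk
    obtain ⟨u, hu⟩ := hiter k
    obtain ⟨w, hw, -⟩ := hu.split hk
    exact ⟨w, hw, edgesIn_univ⟩
  exact ⟨W, c, hc, ρ', hconv, hW⟩

theorem edgeClass_subset {e e' : A × Bool} {p : FreeGroup A}
    (hp : β.Connects p (Z.init e) (Z.init e')) {ρ ρ' : InfWord A}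
    (hρ : ConvergesTo (fun k => β.hom^[k] (FreeGroup.mk [e])) ρ)
    (hρ' : ConvergesTo (fun k => β.hom^[k] (FreeGroup.mk [e'])) ρ') (ht : IsTranslate p ρ' ρ) :
    edgeClass β Λ e ⊆ edgeClass β Λ e' := by
  rintro W ⟨c, hc, ρW, h1, h2⟩
  refine ⟨c * p, hc.trans hp, ρW, ?_, h2⟩
  have := (isTranslate_of_convergesTo hρ h1).convergesTo (ht.convergesTo hρ')
  simpa only [mul_assoc] using this

include T

theorem isAttractingFixedWord_of_mem_edgeClass [Finite V] [Finite A] (hfix : β.onV v₀ = v₀) {e : A × Bool}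
    (he : e.1 ∉ S₀) (hD : β.D e = some e) (hW : W ∈ edgeClass β Λ e) :
    IsAttractingFixedWord Λ (β.induced β.invariant_univ hfix) W := by
  obtain ⟨c, hc, ρ, h1, h2⟩ := hW
  obtain ⟨ρe, hρe⟩ := T.exists_edgeRay he hD
  rw [isAttractingFixedWord_iff_ray β.invariant_univ hfix h2]
  exact (T.isAttractingRay_edgeRay he hD hρe).translate hc.2.2.2 (isTranslate_of_convergesTo hρe h1)

/-- Two fixed paths c, c' from v₀ to the origin of e differ by the fixed loop c'c⁻¹, and multiplying
c by a fixed loop gives another admissible path. -/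
theorem edgeClass_eq_of_mem [Finite V] [Finite A] (hfix : β.onV v₀ = v₀) {e : A × Bool}
    (he : e.1 ∉ S₀) (hD : β.D e = some e) (hW : W ∈ edgeClass β Λ e) :
    edgeClass β Λ e = {W' | IsAttractingFixedWord Λ (β.induced β.invariant_univ hfix) W' ∧
      FixEquiv Λ (β.induced β.invariant_univ hfix) W W'} := by
  obtain ⟨c, hc, ρ, h1, h2⟩ := hW
  have hmul : ∀ (U : Z.pi1 Set.univ v₀) (i : ℕ), basisEmbedding Λ (Λ.repr U * W.trunc i) =
      U * basisEmbedding Λ (W.trunc i) := fun U i => by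
    rw [_root_.map_mul, basisEmbedding_repr]
  ext W'
  constructor
  · intro hW'
    refine ⟨isAttractingFixedWord_of_mem_edgeClass T hfix he hD hW', ?_⟩
    obtain ⟨c', hc', ρ', h1', h2'⟩ := hW'
    have hU := hc'.trans hc.symm
    refine ⟨⟨c' * c⁻¹, mem_pi1_iff.2 ⟨hU.2.2.1, edgesIn_univ⟩⟩, Subtype.ext hU.2.2.2, ?_⟩
    refine (convergesTo_basisEmbedding_iff h2').1 ?_
    simp_rw [hmul]
    refine (isTranslate_of_convergesTo h1 ?_).convergesTo h2
    simpa [mul_assoc] using h1'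
  · rintro ⟨-, U, hU, hconv⟩
    have hUc : β.Connects (U : FreeGroup A) v₀ v₀ :=
      ⟨hfix, hfix, (mem_pi1_iff.1 U.2).1, congrArg Subtype.val hU⟩
    obtain ⟨ρ', ht⟩ := exists_isTranslate (U : FreeGroup A) ρ
    obtain ⟨ρ'', h3⟩ := exists_boundary_ray Λ W'
    have h4 := (convergesTo_basisEmbedding_iff h3).2 hconv
    simp_rw [hmul] at h4
    obtain rfl := h4.unique (ht.convergesTo h2)
    refine ⟨U * c, hUc.trans hc, ρ'', ?_, h3⟩
    simpa only [mul_assoc] using ht.convergesTo h1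

/-- Loops c's c'⁻¹ with s in `S₀` have L-length bounded in terms of c' alone, so they cannot follow
a translate of β^∞(e), whose L-length is infinite. -/
theorem not_comesFrom_of_mem_edgeClass [Finite A] {n₀ : V → ℕ}
    (Λ₀ : ∀ v, FreeGroupBasis (Fin (n₀ v)) (Z.pi1 S₀ v)) {e : A × Bool}
    (he : e.1 ∉ S₀) (hD : β.D e = some e) (hW : W ∈ edgeClass β Λ e) :
    ¬ ComesFrom β T.isRTTPair.invariant Λ Λ₀ W := by
  rintro ⟨v, c', hc', U, -, hU⟩
  obtain ⟨c, hc, ρ, h1, h2⟩ := hW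
  obtain ⟨ρe, hρe⟩ := T.exists_edgeRay he hD
  have h3 := (convergesTo_basisEmbedding_iff h2).2 hU
  simp_rw [basisEmbedding_repr] at h3
  have h4 := (isTranslate_of_convergesTo hρe h1).symm.convergesTo h3
  obtain ⟨m, hm⟩ := T.exists_lt_pathLength_trunc he hD hρe
    (pathLength T.L c⁻¹ + (pathLength T.L c' + pathLength T.L c'⁻¹))
  obtain ⟨i, hi⟩ := (convergesTo_iff.1 h4 m).exists
  have h5 := pathLength_mono T.L_nonneg (InfWord.le_wedge_iff.1 hi)
  set s : Z.pi1 S₀ v := (Λ₀ v).repr.symm (U.trunc i)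
  have h6 : (Z.transport S₀ hc'.2.2.1 s : FreeGroup A) = c' * s * c'⁻¹ := rfl
  have h7 : pathLength T.L (s : FreeGroup A) = 0 :=
    listLength_eq_zero T.L_eq_zero (mem_pi1_iff.1 s.2).2
  rw [h6] at h5
  have h8 := pathLength_mul_le T.L_nonneg c⁻¹ (c' * s * c'⁻¹)
  have h9 := pathLength_mul_le T.L_nonneg (c' * s) c'⁻¹
  have h10 := pathLength_mul_le T.L_nonneg c' (s : FreeGroup A)
  linarith

/-- If `β^∞(e₁)` and `β^∞(e₂)` are translates of each other by a fixed path, then this path is an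
indivisible Nielsen path beginning with `e₁` and ending with the reverse of `e₂`. -/
theorem isIndivisibleNielsen_of_isTranslate {e₁ e₂ : A × Bool} (he₁ : e₁.1 ∉ S₀) (he₂ : e₂.1 ∉ S₀)
    (hD₁ : β.D e₁ = some e₁) (hD₂ : β.D e₂ = some e₂) (hne : e₁ ≠ e₂) {ρ₁ ρ₂ : InfWord A}
    (hρ₁ : ConvergesTo (fun k => β.hom^[k] (FreeGroup.mk [e₁])) ρ₁)
    (hρ₂ : ConvergesTo (fun k => β.hom^[k] (FreeGroup.mk [e₂])) ρ₂) {p : FreeGroup A}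
    (hp : β.Connects p (Z.init e₁) (Z.init e₂)) (ht : IsTranslate p ρ₂ ρ₁) :
    β.IsIndivisibleNielsen p ∧ p.toWord.head? = some e₁ ∧ p⁻¹.toWord.head? = some e₂ := by
  have hp1 : p ≠ 1 := by
    rintro rfl
    apply hne
    rw [← T.edgeRay_zero he₁ hD₁ hρ₁, ← T.edgeRay_zero he₂ hD₂ hρ₂]
    congr 1
    refine ConvergesTo.unique (g := fun i => 1 * ρ₂.trunc i) (ht.convergesTo (convergesTo_trunc ρ₂)) ?_
    simpa using convergesTo_trunc ρ₂
  obtain ⟨q₁, q₂, hq, hq₁, hq₂⟩ := ht.exists_halves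
  -- Points of the edge rays move strictly ahead, so q₁ and q₂ have no nontrivial fixed initial
  -- segment. In a division p = ab either a lies within q₁, or b⁻¹ lies within q₂; both are
  -- excluded.
  have fix₁ : ∀ g, β.hom g = g → g.toWord <+: q₁.toWord → g = 1 := fun g hg hpre => by
    by_contra h
    exact T.hom_ne_of_prefix_edgeRay he₁ hD₁ hρ₁
      (InfWord.norm_le_wedge_of_prefix hpre (hpre.length_le.trans hq₁)) h hg
  have fix₂ : ∀ g, β.hom g = g → g.toWord <+: q₂.toWord → g = 1 := fun g hg hpre => by
    by_contra h
    exact T.hom_ne_of_prefix_edgeRay he₂ hD₂ hρ₂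
      (InfWord.norm_le_wedge_of_prefix hpre (hpre.length_le.trans hq₂)) h hg
  have hq' : p⁻¹.toWord = q₂.toWord ++ q₁⁻¹.toWord := by
    rw [toWord_inv, hq, invRev_append, toWord_inv, toWord_inv, invRev_invRev]
  have hinv : β.hom p⁻¹ = p⁻¹ := hp.symm.2.2.2
  have hq₁1 : q₁ ≠ 1 := by
    rintro rfl
    refine hp1 (inv_eq_one.1 (fix₂ p⁻¹ hinv ?_))
    rw [hq']; simp
  have hq₂1 : q₂ ≠ 1 := by
    rintro rfl
    refine hp1 (fix₁ p hp.2.2.2 ?_)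
    rw [hq]; simp
  refine ⟨⟨⟨hp1, _, _, hp⟩, ?_⟩, ?_, ?_⟩
  · rintro ⟨a, b, ⟨ha1, -, -, -, -, -, ha⟩, ⟨hb1, -, -, -, -, -, hb⟩, hab⟩
    have hpa : a.toWord <+: p.toWord := ⟨_, hab.symm⟩
    have hpq : q₁.toWord <+: p.toWord := ⟨_, hq.symm⟩
    rcases List.prefix_or_prefix_of_prefix hpa hpq with h | h
    · exact ha1 (fix₁ a ha h)
    · have hpb : b⁻¹.toWord <+: p⁻¹.toWord := ⟨a⁻¹.toWord, by
        rw [toWord_inv p, hab, invRev_append, toWord_inv, toWord_inv]⟩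
      have hpq' : q₂.toWord <+: p⁻¹.toWord := ⟨_, hq'.symm⟩
      refine hb1 (inv_eq_one.1 (fix₂ b⁻¹ (by rw [_root_.map_inv, hb]) ?_))
      refine List.prefix_of_prefix_length_le hpb hpq' ?_
      have h1 := congrArg List.length (hab.symm.trans hq)
      have h2 := h.length_le
      simp only [toWord_inv, invRev_length, List.length_append] at h1 ⊢
      omega
  · rw [hq, List.head?_append_of_ne_nil _ (fun h => hq₁1 (toWord_eq_nil_iff.1 h)),
      InfWord.head?_of_norm_le_wedge hq₁ hq₁1, T.edgeRay_zero he₁ hD₁ hρ₁]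
  · rw [hq', List.head?_append_of_ne_nil _ (fun h => hq₂1 (toWord_eq_nil_iff.1 h)),
      InfWord.head?_of_norm_le_wedge hq₂ hq₂1, T.edgeRay_zero he₂ hD₂ hρ₂]

/-- A common element is a common end of c₁β^∞(e₁) and c₂β^∞(e₂), so c₁⁻¹c₂ is the required Nielsen
path. Conversely, β^k(p₁) and β^k(p₂) converge to the two edge rays because p₁, p₂ are legal, and
they differ by the fixed factor p, so the rays are translates of each other by p. -/
theorem edgeClass_eq_iff [Finite V] [Finite A] {e₁ e₂ : A × Bool} (he₁ : e₁.1 ∉ S₀)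
    (he₂ : e₂.1 ∉ S₀) (hD₁ : β.D e₁ = some e₁) (hD₂ : β.D e₂ = some e₂) (hne : e₁ ≠ e₂)
    (hc₁ : ∃ c, β.Connects c v₀ (Z.init e₁)) :
    edgeClass β Λ e₁ = edgeClass β Λ e₂ ↔
      ∃ p p₁ p₂ : FreeGroup A, β.IsIndivisibleNielsen p ∧ MeetsCompl S₀ p ∧
        IsLegalHalves β S₀ T.L p p₁ p₂ ∧
        p₁.toWord.head? = some e₁ ∧ p₂.toWord.head? = some e₂ := by
  obtain ⟨ρ₁, hρ₁⟩ := T.exists_edgeRay he₁ hD₁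
  obtain ⟨ρ₂, hρ₂⟩ := T.exists_edgeRay he₂ hD₂
  constructor
  · intro heq
    obtain ⟨c, hc⟩ := hc₁
    obtain ⟨W, hW⟩ := edgeClass_nonempty Λ hc hρ₁
    obtain ⟨c₂, hc₂, ρ', h3, h4⟩ := heq ▸ hW
    obtain ⟨c₁, hc₁, ρ, h1, h2⟩ := hW
    obtain rfl := h2.unique h4
    have hp := hc₁.symm.trans hc₂
    have ht : IsTranslate (c₁⁻¹ * c₂) ρ₂ ρ₁ := by
      refine isTranslate_of_convergesTo hρ₂ ?_
      simpa only [mul_assoc] using (isTranslate_of_convergesTo hρ₁ h1).symm.convergesTo h3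
    obtain ⟨h5, h6, h7⟩ :=
      isIndivisibleNielsen_of_isTranslate T he₁ he₂ hD₁ hD₂ hne hρ₁ hρ₂ hp ht
    have hM : MeetsCompl S₀ (c₁⁻¹ * c₂) := ⟨e₁, List.mem_of_mem_head? h6, he₁⟩
    obtain ⟨p₁, p₂, hpp⟩ := T.nielsen_form _ h5 hM
    refine ⟨_, p₁, p₂, h5, hM, hpp, ?_, ?_⟩
    · obtain ⟨hw, -, -, -, ⟨x, y, hx, hy, -⟩, -⟩ := hpp
      rw [← h6]
      exact head?_of_prefix ⟨_, hw.symm⟩ (by rintro h; simp [h] at hx)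
    · obtain ⟨hw, -, -, -, ⟨x, y, hx, hy, -⟩, -⟩ := hpp
      rw [← h7]
      refine head?_of_prefix ⟨p₁⁻¹.toWord, ?_⟩ (by rintro h; simp [h] at hy)
      rw [toWord_inv (c₁⁻¹ * c₂), hw, invRev_append, toWord_inv p₂, invRev_invRev, toWord_inv]
  · rintro ⟨p, p₁, p₂, ⟨⟨-, u, v, hp⟩, -⟩, -, ⟨hw, hl₁, hl₂, -⟩, hh₁, hh₂⟩
    have hw' : p⁻¹.toWord = p₂.toWord ++ p₁⁻¹.toWord := by
      rw [toWord_inv p, hw, invRev_append, toWord_inv p₂, invRev_invRev, toWord_inv]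
    obtain ⟨w₁, hp₁, -⟩ := hp.2.2.1.split ⟨_, hw.symm⟩
    obtain ⟨w₂, hp₂, -⟩ := hp.2.2.1.inv.split ⟨_, hw'.symm⟩
    have hstart : ∀ {q : FreeGroup A} {e : A × Bool} {x y : V}, Z.IsPath x q y →
        q.toWord.head? = some e → Z.init e = x := fun {q e x y} hq hh => by
      obtain ⟨l, hl⟩ := List.head?_eq_some_iff.1 hh
      unfold IsPath at hq
      rw [hl] at hq
      exact hq.1
    obtain rfl := hstart hp₁ hh₁
    obtain rfl := hstart hp₂ hh₂
    have h1 := T.convergesTo_iterate he₁ hρ₁ hp₁ hl₁ hh₁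
    have h2 := T.convergesTo_iterate he₂ hρ₂ hp₂ hl₂ hh₂
    have hpeq : p = p₁ * p₂⁻¹ := eq_mul_of_toWord hw
    have hk : ∀ k, β.hom^[k] p₁ = p * β.hom^[k] p₂ := fun k => by
      induction k with
      | zero => simp [hpeq]
      | succ k ih => rw [Function.iterate_succ_apply', Function.iterate_succ_apply', ih,
          _root_.map_mul, hp.2.2.2]
    simp_rw [hk] at h1
    have ht := isTranslate_of_convergesTo h2 h1
    exact (edgeClass_subset hp hρ₁ hρ₂ ht).antisymm (edgeClass_subset hp.symm hρ₂ hρ₁ ht.symm)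

end EdgeClass

/-! ### Fixed points on attracting rays. -/

section Converse

variable {V A : Type*} [DecidableEq A] {Z : CellGraph V A} {β : GraphMap Z}
  {S₀ : Set A} {ρ : InfWord A}

/-- The image of an edge crosses this edge positively, and only at one of its ends. -/
theorem IsRTTPair.eq_nil_of_imageWord (H : IsRTTPair β S₀) {x : A × Bool}
    {l m : List (A × Bool)} (h : β.imageWord [x] = l ++ x :: m) (hm : m ≠ []) : l = [] := by
  obtain ⟨a, b⟩ := x
  cases b
  · have h1 : (β.onE a).toWord = invRev m ++ (a, true) :: invRev l := by
      have h2 := imageWord_bar (β := β) (a, false)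
      rw [h, invRev_append, invRev_cons_eq, List.append_assoc] at h2
      have h3 : β.imageWord [bar (a, false)] = (β.onE a).toWord := by simp [imageWord, hom, bar]
      rw [← h3, h2]; rfl
    rcases (H.fixed_points_vertices a _ _ _ h1 rfl).2 with h2 | h2
    · exact absurd (by simpa [invRev] using h2) hm
    · simpa [invRev] using h2
  · have h1 : β.imageWord [(a, true)] = (β.onE a).toWord := by simp [imageWord, hom]
    exact (H.fixed_points_vertices a _ _ _ (h1 ▸ h) rfl).2.resolve_right hm

/-- On an attracting ray there is a last point which is not moved ahead; it is fixed and the edge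
behind it is initially expanded along itself. -/
theorem IsAttractingRay.exists_fixed_point [Finite A] (H : IsRTTPair β S₀)
    (h : IsAttractingRay β.hom ρ) : ∃ i, β.hom (ρ.trunc i) = ρ.trunc i ∧
      β.D (ρ.seq i) = some (ρ.seq i) ∧ ∀ k > i, k < ρ.wedge (β.hom (ρ.trunc k)) := by
  classical
  -- The least such N is positive because the origin `ρ.trunc 0` is not moved ahead; the point
  -- sought is i = N − 1.
  have hex : ∃ N, ∀ k ≥ N, k < ρ.wedge (β.hom (ρ.trunc k)) := isAttractingRay_iff.1 h 1
  obtain ⟨i, hi⟩ : ∃ i, Nat.find hex = i + 1 := by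
    refine Nat.exists_eq_succ_of_ne_zero fun h0 => ?_
    have h1 := Nat.find_spec hex 0 h0.le
    have h2 : ρ.trunc 0 = 1 := rfl
    rw [h2, _root_.map_one] at h1
    exact absurd (ρ.wedge_le_norm 1) (by rw [FreeGroup.norm_one]; omega)
  have hgt : ∀ k > i, k < ρ.wedge (β.hom (ρ.trunc k)) := fun k hk =>
    Nat.find_spec hex k (by omega)
  have hle : ρ.wedge (β.hom (ρ.trunc i)) ≤ i := by
    by_contra! hlt
    refine Nat.find_min hex (m := i) (by omega) fun k hk => ?_
    rcases hk.eq_or_lt with rfl | hk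
    · exact hlt
    · exact hgt k hk
  have hsucc := InfWord.le_wedge_iff.1 (show i + 1 + 1 ≤ _ from hgt (i + 1) (by omega))
  obtain ⟨t, hy⟩ := hsucc
  have hword : ∀ k, (ρ.trunc (k + 1)).toWord = (ρ.trunc k).toWord ++ [ρ.seq k] := fun k => by
    rw [InfWord.toWord_trunc, InfWord.toWord_trunc, List.range_succ, List.map_append]; rfl
  -- The image of the edge `ρ.seq i` starts at the image of `ρ.trunc i`, goes back along r to the
  -- branch point l, and then forward along s to the image of `ρ.trunc (i + 1)`. The branch point is
  -- at height at most i, and the endpoint is beyond height i + 1.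
  obtain ⟨l, r, s, hx, hy', hrs⟩ := exists_common_prefix (β.hom (ρ.trunc i)).toWord
    (β.hom (ρ.trunc (i + 1))).toWord
  have himage : β.imageWord [ρ.seq i] = invRev r ++ s := by
    rw [← toWord_inv_mul hx hy' hrs, ← _root_.map_inv, ← _root_.map_mul]
    have : (ρ.trunc i)⁻¹ * ρ.trunc (i + 1) = FreeGroup.mk [ρ.seq i] :=
      toWord_injective (toWord_inv_mul_of_prefix (hword i))
    rw [this]; rfl
  have hpre : ∀ k, k ≤ i + 2 → (ρ.trunc k).toWord <+: (β.hom (ρ.trunc (i + 1))).toWord :=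
    fun k hk => (ρ.trunc_prefix_trunc hk).trans ⟨t, hy⟩
  have hl : l.length ≤ i := by
    by_contra! hlt
    have h1 : (ρ.trunc (i + 1)).toWord <+: l :=
      List.prefix_of_prefix_length_le (hpre (i + 1) (by omega)) ⟨s, hy'.symm⟩
        (by simpa [InfWord.toWord_trunc] using hlt)
    have h2 := InfWord.le_wedge_iff.2 (h1.trans ⟨r, hx.symm⟩)
    omega
  obtain ⟨mid, hmid⟩ : l <+: (ρ.trunc i).toWord :=
    List.prefix_of_prefix_length_le ⟨s, hy'.symm⟩ (hpre i (by omega))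
      (by simpa [InfWord.toWord_trunc] using hl)
  have hs : s = mid ++ ρ.seq i :: ρ.seq (i + 1) :: t := by
    rw [hy', hword, hword, ← hmid] at hy
    simp only [List.append_assoc, List.append_cancel_left_eq] at hy
    rw [← hy]; simp
  rw [hs, ← List.append_assoc] at himage
  -- The image of `ρ.seq i` crosses this edge and then goes on, so without interior fixed points the
  -- crossing comes first. Hence nothing precedes it: r and `mid` are empty, which means that the
  -- point is fixed.
  have hnil := H.eq_nil_of_imageWord himage (by simp)
  rw [List.append_eq_nil_iff] at hnil
  obtain ⟨hr, rfl⟩ := hnil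
  obtain rfl : r = [] := by simpa [invRev] using hr
  refine ⟨i, toWord_injective ?_, ?_, hgt⟩
  · rw [hx, ← hmid]
  · have : β.D (ρ.seq i) = (β.imageWord [ρ.seq i]).head? := rfl
    rw [this, himage]; simp

theorem lt_wedge_drop {i : ℕ} (hfix : β.hom (ρ.trunc i) = ρ.trunc i)
    (hgt : ∀ k > i, k < ρ.wedge (β.hom (ρ.trunc k))) {m : ℕ} (hm : 1 ≤ m) :
    m < (ρ.drop i).wedge (β.hom ((ρ.drop i).trunc m)) := by
  have h1 := hgt (i + m) (by omega)
  have h2 := InfWord.le_wedge_drop (show i + (m + 1) ≤ _ from h1)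
  rwa [InfWord.trunc_add, _root_.map_mul, hfix, inv_mul_cancel_left] at h2

/-- A ray that begins with an edge of the invariant subgraph and whose points are all moved ahead
stays in this subgraph. -/
theorem edgesIn_of_lt_wedge (hS : β.Invariant S₀) (h0 : (ρ.seq 0).1 ∈ S₀)
    (hgt : ∀ m ≥ 1, m < ρ.wedge (β.hom (ρ.trunc m))) (m : ℕ) : EdgesIn S₀ (ρ.trunc m) := by
  have key : EdgesIn S₀ (ρ.trunc (m + 1)) := by
    induction m with
    | zero =>
      intro x hx
      rw [InfWord.toWord_trunc] at hx
      obtain rfl : x = ρ.seq 0 := by simpa using hx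
      exact h0
    | succ m ih =>
      -- The image of the first m + 1 edges stays in `S₀` and contains the first m + 2 edges of the
      -- ray.
      exact (hS.edgesIn_hom ih).of_prefix (InfWord.le_wedge_iff.1 (hgt (m + 1) (by omega)))
  exact key.of_prefix (ρ.trunc_prefix_trunc (by omega))

/-- Two rays beginning with the same edge whose points are all moved ahead coincide. -/
theorem eq_of_lt_wedge {ρ' : InfWord A} (h0 : ρ.seq 0 = ρ'.seq 0)
    (hgt : ∀ m ≥ 1, m < ρ.wedge (β.hom (ρ.trunc m)))
    (hgt' : ∀ m ≥ 1, m < ρ'.wedge (β.hom (ρ'.trunc m))) : ρ = ρ' := by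
  have key : ∀ m, ρ.trunc (m + 1) = ρ'.trunc (m + 1) := by
    intro m
    induction m with
    | zero => refine toWord_injective ?_; simp [InfWord.toWord_trunc, h0]
    | succ m ih =>
      -- The image of the common initial segment of length m + 1 determines the next edge of both
      -- rays.
      have h1 := InfWord.le_wedge_iff.1 (show m + 1 + 1 ≤ _ from hgt (m + 1) (by omega))
      have h2 := InfWord.le_wedge_iff.1 (show m + 1 + 1 ≤ _ from hgt' (m + 1) (by omega))
      rw [← ih] at h2
      refine toWord_injective ?_
      exact (List.prefix_of_prefix_length_le h1 h2 (by simp [InfWord.toWord_trunc])).eq_of_length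
        (by simp [InfWord.toWord_trunc])
  refine (convergesTo_trunc ρ).unique (convergesTo_iff.2 fun m => ?_)
  filter_upwards [eventually_ge_atTop (m + 1)] with p hp
  obtain ⟨q, rfl⟩ := Nat.exists_eq_add_of_le' (show 1 ≤ p by omega)
  rw [key, InfWord.wedge_trunc]
  omega

end Converse

/-! ### The dichotomy for attracting words and the main theorem. -/

section Main

variable {V A : Type*} [DecidableEq A] {Z : CellGraph V A} {β : GraphMap Z}
  {S₀ : Set A} (T : Type3RTT β S₀) {v₀ : V} {n : ℕ}
  {Λ : FreeGroupBasis (Fin n) (Z.pi1 Set.univ v₀)} {W : InfWord (Fin n)}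

include T

/-- The last fixed point writes the ray as a fixed path followed by a tail whose points all move
ahead. If the first edge of the tail is in `S₀`, the tail is an attracting ray of the subgraph;
otherwise it coincides with β^∞(e), which begins with the same edge and has the same property. -/
theorem comesFrom_or_mem_edgeClass [Finite V] [Finite A] {n₀ : V → ℕ}
    (Λ₀ : ∀ v, FreeGroupBasis (Fin (n₀ v)) (Z.pi1 S₀ v)) (hfix : β.onV v₀ = v₀)
    (hW : IsAttractingFixedWord Λ (β.induced β.invariant_univ hfix) W) :
    ComesFrom β T.isRTTPair.invariant Λ Λ₀ W ∨
      ∃ e c, e.1 ∉ S₀ ∧ β.D e = some e ∧ β.Connects c v₀ (Z.init e) ∧ W ∈ edgeClass β Λ e := by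
  obtain ⟨ρ, hρ⟩ := exists_boundary_ray Λ W
  rw [isAttractingFixedWord_iff_ray β.invariant_univ hfix hρ] at hW
  obtain ⟨i, hi, hD, hgt⟩ := hW.exists_fixed_point T.isRTTPair
  have hgt' := fun m (hm : m ≥ 1) => lt_wedge_drop hi hgt hm
  have hzero : (ρ.drop i).seq 0 = ρ.seq i := rfl
  set e := ρ.seq i with he
  have hpath : ∀ m, ∃ u, Z.IsPath v₀ (ρ.trunc i) (Z.init e) ∧
      Z.IsPath (Z.init e) ((ρ.drop i).trunc m) u := by
    intro m
    obtain ⟨u, hu, -⟩ := isPath_trunc hρ (i + (m + 1))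
    unfold IsPath at hu
    rw [InfWord.toWord_trunc_add] at hu
    obtain ⟨w, h1, h2⟩ := isWalk_append.1 hu
    have h3 : Z.init e = w := by
      rw [InfWord.toWord_trunc, List.range_succ_eq_map] at h2
      exact h2.1
    subst h3
    obtain ⟨u', hu', -⟩ := IsPath.split (Z := Z) h2 ((ρ.drop i).trunc_prefix_trunc (Nat.le_succ m))
    exact ⟨u', h1, hu'⟩
  obtain ⟨-, hpi, -⟩ := hpath 0
  have hc : β.Connects (ρ.trunc i) v₀ (Z.init e) := by
    refine ⟨hfix, ?_, hpi, hi⟩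
    have := β.isPath_hom hpi
    rw [hi, hfix] at this
    exact IsWalk.unique this hpi
  have ht := ρ.isTranslate_drop i
  by_cases heS : e.1 ∈ S₀
  · left
    have hin := edgesIn_of_lt_wedge T.isRTTPair.invariant (by rwa [hzero]) hgt'
    obtain ⟨U, hU⟩ := exists_boundary_word (Λ₀ (Z.init e)) (ρ := ρ.drop i) fun m =>
      ⟨(hpath m).choose, (hpath m).choose_spec.2, hin m⟩
    refine ⟨Z.init e, ρ.trunc i, hc, U, ?_, ?_⟩
    · rw [isAttractingFixedWord_iff_ray T.isRTTPair.invariant hc.2.1 hU]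
      exact hW.translate hc.symm.2.2.2 ht.symm
    · refine (convergesTo_basisEmbedding_iff hρ).1 ?_
      -- Transported loops are c s c⁻¹, whereas the translate of the tail is a limit of paths c s;
      -- the final c⁻¹ is a bounded error.
      refine (ht.convergesTo hU).of_norm_le (ρ.trunc i).norm fun k => ?_
      rw [basisEmbedding_repr]
      have h1 : (Z.transport S₀ hc.2.2.1 ((Λ₀ (Z.init e)).repr.symm (U.trunc k)) : FreeGroup A) =
          ρ.trunc i * basisEmbedding (Λ₀ (Z.init e)) (U.trunc k) * (ρ.trunc i)⁻¹ := rfl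
      rw [h1, inv_mul_cancel_left, norm_inv_eq]
  · right
    refine ⟨e, ρ.trunc i, heS, hD, hc, ρ.trunc i, hc, ρ, ?_, hρ⟩
    obtain ⟨ρe, hρe⟩ := T.exists_edgeRay heS hD
    have : ρ.drop i = ρe := eq_of_lt_wedge (by rw [hzero, T.edgeRay_zero heS hD hρe]) hgt'
      fun m hm => T.lt_wedge_edgeRay heS hD hρe hm
    exact ht.convergesTo (this ▸ hρe)

end Main

end Development

theorem lemma4p3 {V A : Type*} [Finite V] [Finite A] [DecidableEq A]
    (Z : CellGraph V A) (β : GraphMap Z) (S₀ : Set A) (T : Type3RTT β S₀)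
    (F : Set V) (hF : β.IsFixedPointClass F) (v₀ : V) (hv₀ : v₀ ∈ F) (hfix : β.onV v₀ = v₀)
    (n : ℕ) (Λ : FreeGroupBasis (Fin n) (Z.pi1 Set.univ v₀))
    (n₀ : V → ℕ) (Λ₀ : ∀ v, FreeGroupBasis (Fin (n₀ v)) (Z.pi1 S₀ v)) :
    (∀ e ∈ Delta β S₀ F,
      edgeClass β Λ e ∈ attractingClasses Λ (β.induced β.invariant_univ hfix) ∧
      ∀ W ∈ edgeClass β Λ e, ¬ ComesFrom β T.isRTTPair.invariant Λ Λ₀ W) ∧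
    (∀ e₁ ∈ Delta β S₀ F, ∀ e₂ ∈ Delta β S₀ F, e₁ ≠ e₂ →
      (edgeClass β Λ e₁ = edgeClass β Λ e₂ ↔
        ∃ p p₁ p₂ : FreeGroup A, β.IsIndivisibleNielsen p ∧ MeetsCompl S₀ p ∧
          IsLegalHalves β S₀ T.L p p₁ p₂ ∧
          p₁.toWord.head? = some e₁ ∧ p₂.toWord.head? = some e₂)) ∧
    (∀ C ∈ attractingClasses Λ (β.induced β.invariant_univ hfix),
      (∀ W ∈ C, ¬ ComesFrom β T.isRTTPair.invariant Λ Λ₀ W) →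
        ∃ e ∈ Delta β S₀ F, C = edgeClass β Λ e) := by
  refine ⟨fun e he => ⟨?_, fun W hW => not_comesFrom_of_mem_edgeClass T Λ₀ he.1 he.2.2 hW⟩,
    fun e₁ h₁ e₂ h₂ hne => ?_, ?_⟩
  · obtain ⟨he, hin, hD⟩ := he
    obtain ⟨c, hc⟩ := (hF.mem_iff hv₀).1 hin
    obtain ⟨ρ, hρ⟩ := T.exists_edgeRay he hD
    obtain ⟨W, hW⟩ := edgeClass_nonempty Λ hc hρ
    exact ⟨W, isAttractingFixedWord_of_mem_edgeClass T hfix he hD hW,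
      edgeClass_eq_of_mem T hfix he hD hW⟩
  · exact edgeClass_eq_iff T h₁.1 h₂.1 h₁.2.2 h₂.2.2 hne ((hF.mem_iff hv₀).1 h₁.2.1)
  · rintro C ⟨W, hW, rfl⟩ hC
    rcases comesFrom_or_mem_edgeClass T Λ₀ hfix hW with h | ⟨e, c, he, hD, hc, hmem⟩
    · exact absurd h (hC W ⟨hW, fixEquiv_refl _ _ W⟩)
    · exact ⟨e, ⟨he, (hF.mem_iff hv₀).2 ⟨c, hc⟩, hD⟩, (edgeClass_eq_of_mem T hfix he hD hmem).symm⟩
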